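/- Let $p\ge 1$, $n_0>p$ and $\ell\ge 0$ be integers, and put $n_\ell=n_0 2^\ell$, $h_\ell=1/n_\ell$. Let $S_{p,\ell}$ be the space of all functions in $C^{p-1}(0,1)$ that are polynomials of degree at most $p$ on each subinterval $((i-1)h_\ell,\,i h_\ell)$, $i=1,\dots,n_\ell$, and let $\widetilde S_{p,\ell}\subset S_{p,\ell}$ be the subspace of those $u$ whose odd derivatives of order less than $p$ vanish at the boundary, i.e. $u^{(2l+1)}(0)=u^{(2l+1)}(1)=0$ (as one-sided limits) for all integers $l\ge 0$ with $2l+1<p$. On $\Omega=(0,1)^2$ let $\mathcal S_{p,\ell}=S_{p,\ell}\otimes S_{p,\ell}$ and $\widetilde{\mathcal S}_{p,\ell}=\widetilde S_{p,\ell}\otimes\widetilde S_{p,\ell}$ be the spans of the products $(x,y)\mapsto f(x)g(y)$ with $f,g\in S_{p,\ell}$, respectively $f,g\in\widetilde S_{p,\ell}$, and let $$(u,v)_{\mathcal A}=(\partial_x u,\partial_x v)_{L^2(\Omega)}+(\partial_y u,\partial_y v)_{L^2(\Omega)}+(u,v)_{L^2(\Omega)},\qquad \|u\|_{\mathcal A}=(u,u)_{\mathcal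 A}^{1/2}.$$ **Theorem 5.1.** There is a constant $c>0$, independent of $p$, $n_0$ and $\ell$, such that for all integers $p\ge1$, $n_0>p$ and $\ell\ge0$ the following holds. There is exactly one linear map $\widetilde{\mathcal T}_\ell:\mathcal S_{p,\ell}\to\widetilde{\mathcal S}_{p,\ell}$ such that $(u-\widetilde{\mathcal T}_\ell u,\,w)_{\mathcal A}=0$ for all $u\in\mathcal S_{p,\ell}$ and $w\in\widetilde{\mathcal S}_{p,\ell}$ (the $\mathcal A$-orthogonal projector), and it satisfies $$\|(I-\widetilde{\mathcal T}_\ell)u_\ell\|_{L^2(\Omega)}\le c\,h_\ell\,\|u_\ell\|_{\mathcal A}\qquad\text{for all } u_\ell\in\mathcal S_{p,\ell}.$$ -/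

import Mathlib

open Set Filter Topology MeasureTheory

namespace SplineMG

/-- The number `n_ℓ = n₀ 2^ℓ` of subintervals of the grid of level `ℓ`. -/
def gridCount (n₀ ℓ : ℕ) : ℕ := n₀ * 2 ^ ℓ

/-- The grid size `h_ℓ = 1 / n_ℓ`. -/
noncomputable def gridSize (n₀ ℓ : ℕ) : ℝ := 1 / (gridCount n₀ ℓ : ℝ)

/-- The spline space `S_{p,ℓ}(0,1)` (for `p ≥ 1`): functions of class `C^{p-1}` on the open interval
`(0,1)` which coincide with a polynomial of degree at most `p` on every open subinterval
`(i h_ℓ, (i+1) h_ℓ)`, `0 ≤ i < n_ℓ`. A function on `(0,1)` is represented by its extension by zero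
to `ℝ`, so that equality in this space is equality of functions on `(0,1)`. -/
def splineSpace (p n₀ ℓ : ℕ) : Submodule ℝ (ℝ → ℝ) where
  carrier := {u | (∀ x, x ∉ Ioo (0 : ℝ) 1 → u x = 0) ∧
    ContDiffOn ℝ ((p - 1 : ℕ) : WithTop ℕ∞) u (Ioo 0 1) ∧
    ∀ i : ℕ, i < gridCount n₀ ℓ → ∃ q : Polynomial ℝ, q.natDegree ≤ p ∧
      ∀ x ∈ Ioo ((i : ℝ) * gridSize n₀ ℓ) (((i : ℝ) + 1) * gridSize n₀ ℓ), u x = q.eval x}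
  zero_mem' := ⟨fun _ _ => rfl, contDiffOn_const, fun _ _ => ⟨0, by simp, by simp⟩⟩
  add_mem' := by
    rintro u v ⟨hu0, hu1, hu2⟩ ⟨hv0, hv1, hv2⟩
    refine ⟨fun x hx => by simp [hu0 x hx, hv0 x hx], hu1.add hv1, fun i hi => ?_⟩
    obtain ⟨q, hq, hq'⟩ := hu2 i hi
    obtain ⟨r, hr, hr'⟩ := hv2 i hi
    exact ⟨q + r, Polynomial.natDegree_add_le_of_degree_le hq hr,
      fun x hx => by simp [hq' x hx, hr' x hx]⟩
  smul_mem' := by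
    rintro c u ⟨hu0, hu1, hu2⟩
    refine ⟨fun x hx => by simp [hu0 x hx], contDiffOn_const.smul hu1, fun i hi => ?_⟩
    obtain ⟨q, hq, hq'⟩ := hu2 i hi
    exact ⟨c • q, (Polynomial.natDegree_smul_le c q).trans hq, fun x hx => by simp [hq' x hx]⟩

theorem splineSpace_contDiffAt {p n₀ ℓ k : ℕ} {u : ℝ → ℝ} (hu : u ∈ splineSpace p n₀ ℓ)
    (hk : k < p) {x : ℝ} (hx : x ∈ Ioo (0 : ℝ) 1) : ContDiffAt ℝ (k : WithTop ℕ∞) u x := by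
  have h1 : ContDiffOn ℝ ((p - 1 : ℕ) : WithTop ℕ∞) u (Ioo 0 1) := hu.2.1
  have h2 := h1.contDiffAt (isOpen_Ioo.mem_nhds hx)
  refine h2.of_le ?_
  have : k ≤ p - 1 := by omega
  exact_mod_cast this

/-- The space `S̃_{p,ℓ}(0,1)` of all splines whose odd derivatives of order less than `p` vanish at
the two boundary points. The boundary value of a derivative on the open interval `(0,1)` is its
one-sided limit. -/
def splineTilde (p n₀ ℓ : ℕ) : Submodule ℝ (ℝ → ℝ) where
  carrier := {u | u ∈ splineSpace p n₀ ℓ ∧ ∀ l : ℕ, 2 * l + 1 < p →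
    Tendsto (iteratedDeriv (2 * l + 1) u) (𝓝[>] 0) (𝓝 0) ∧
    Tendsto (iteratedDeriv (2 * l + 1) u) (𝓝[<] 1) (𝓝 0)}
  zero_mem' := by
    refine ⟨Submodule.zero_mem _, fun l _ => ?_⟩
    have h : iteratedDeriv (2 * l + 1) (0 : ℝ → ℝ) = fun _ => 0 := by
      ext x
      simp
    rw [h]
    exact ⟨tendsto_const_nhds, tendsto_const_nhds⟩
  add_mem' := by
    rintro u v ⟨hu, hu'⟩ ⟨hv, hv'⟩
    refine ⟨Submodule.add_mem _ hu hv, fun l hl => ?_⟩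
    have key : ∀ x ∈ Ioo (0 : ℝ) 1, iteratedDeriv (2 * l + 1) u x + iteratedDeriv (2 * l + 1) v x
        = iteratedDeriv (2 * l + 1) (u + v) x := fun x hx =>
      (iteratedDeriv_add (splineSpace_contDiffAt hu hl hx) (splineSpace_contDiffAt hv hl hx)).symm
    constructor
    · have h := (hu' l hl).1.add (hv' l hl).1
      rw [add_zero] at h
      refine h.congr' ?_
      filter_upwards [Ioo_mem_nhdsGT (zero_lt_one' ℝ)] with x hx using key x hx
    · have h := (hu' l hl).2.add (hv' l hl).2
      rw [add_zero] at h
      refine h.congr' ?_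
      filter_upwards [Ioo_mem_nhdsLT (zero_lt_one' ℝ)] with x hx using key x hx
  smul_mem' := by
    rintro c u ⟨hu, hu'⟩
    refine ⟨Submodule.smul_mem _ c hu, fun l hl => ?_⟩
    have key : ∀ x ∈ Ioo (0 : ℝ) 1, c * iteratedDeriv (2 * l + 1) u x
        = iteratedDeriv (2 * l + 1) (c • u) x := fun x hx =>
      (iteratedDeriv_const_smul (splineSpace_contDiffAt hu hl hx) c).symm
    constructor
    · have h := (hu' l hl).1.const_mul c
      rw [mul_zero] at h
      refine h.congr' ?_
      filter_upwards [Ioo_mem_nhdsGT (zero_lt_one' ℝ)] with x hx using key x hx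
    · have h := (hu' l hl).2.const_mul c
      rw [mul_zero] at h
      refine h.congr' ?_
      filter_upwards [Ioo_mem_nhdsLT (zero_lt_one' ℝ)] with x hx using key x hx

/-- The tensor product `V ⊗ W` of two spaces of functions of one variable, as a space of functions
of two variables: the span of the functions `(x, y) ↦ f x * g y`. -/
def tensorSpace (V W : Submodule ℝ (ℝ → ℝ)) : Submodule ℝ (ℝ × ℝ → ℝ) :=
  Submodule.span ℝ {w | ∃ f ∈ V, ∃ g ∈ W, w = fun z => f z.1 * g z.2}

/-- The two-dimensional spline space `S_{p,ℓ}(0,1) ⊗ S_{p,ℓ}(0,1)`. -/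
def splineSpace2 (p n₀ ℓ : ℕ) : Submodule ℝ (ℝ × ℝ → ℝ) :=
  tensorSpace (splineSpace p n₀ ℓ) (splineSpace p n₀ ℓ)

/-- The two-dimensional space `S̃_{p,ℓ}(0,1) ⊗ S̃_{p,ℓ}(0,1)`. -/
def splineTilde2 (p n₀ ℓ : ℕ) : Submodule ℝ (ℝ × ℝ → ℝ) :=
  tensorSpace (splineTilde p n₀ ℓ) (splineTilde p n₀ ℓ)

/-- The open unit square `Ω = (0,1)²`. -/
def unitSquare : Set (ℝ × ℝ) := Ioo (0 : ℝ) 1 ×ˢ Ioo (0 : ℝ) 1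

/-- The partial derivative `∂u/∂x`. Elements of `splineSpace2` are continuous and piecewise
polynomial on the square, so this is defined off finitely many grid lines, bounded there, and
represents the weak derivative. -/
noncomputable def partialX (u : ℝ × ℝ → ℝ) (z : ℝ × ℝ) : ℝ := deriv (fun s => u (s, z.2)) z.1

/-- The partial derivative `∂u/∂y`. -/
noncomputable def partialY (u : ℝ × ℝ → ℝ) (z : ℝ × ℝ) : ℝ := deriv (fun t => u (z.1, t)) z.2

/-- The scalar product of `L²(Ω)`. -/
noncomputable def l2Inner (u v : ℝ × ℝ → ℝ) : ℝ := ∫ z in unitSquare, u z * v z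

/-- The norm of `L²(Ω)`. -/
noncomputable def l2Norm (u : ℝ × ℝ → ℝ) : ℝ := Real.sqrt (l2Inner u u)

/-- The energy scalar product
`(∂ₓu, ∂ₓv)_{L²(Ω)} + (∂_y u, ∂_y v)_{L²(Ω)} + (u, v)_{L²(Ω)}`. -/
noncomputable def energyInner (u v : ℝ × ℝ → ℝ) : ℝ :=
  l2Inner (partialX u) (partialX v) + l2Inner (partialY u) (partialY v) + l2Inner u v

/-- The energy norm. -/
noncomputable def energyNorm (u : ℝ × ℝ → ℝ) : ℝ := Real.sqrt (energyInner u u)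

/-- `T` is the orthogonal projector, with respect to the energy scalar product, from
`S_{p,ℓ} ⊗ S_{p,ℓ}` onto its subspace `S̃_{p,ℓ} ⊗ S̃_{p,ℓ}`: for every `u`, the function `T u` lies
in the subspace and `u - T u` is orthogonal to the subspace. -/
def IsEnergyProjector {p n₀ ℓ : ℕ} (T : splineSpace2 p n₀ ℓ →ₗ[ℝ] splineTilde2 p n₀ ℓ) : Prop :=
  ∀ (u : splineSpace2 p n₀ ℓ) (w : splineTilde2 p n₀ ℓ),
    energyInner ((u : ℝ × ℝ → ℝ) - (T u : ℝ × ℝ → ℝ)) (w : ℝ × ℝ → ℝ) = 0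

end SplineMG

/-! The proof is an Aubin-Nitsche argument carried out inside the discrete space. Choose a basis of
the univariate splines that is orthonormal in L² and orthogonal for the derivative form, with
eigenvalues μ_i (`exists_isEigenbasis`). In tensor coordinates the energy form is diagonal with
weights 1 + μ_i + μ_j, so the dual problem with right-hand side D = u - Tu is solved by entrywise
division, and no elliptic regularity enters. The solution Z is approximated by PZPᵀ, where P = 1 - E
and E is the error operator of a univariate H¹ projector onto S̃. If the energy error of Z is at
most 4h‖D‖, orthogonality gives ‖D‖ ≤ 4h‖D‖_A ≤ 4h‖u‖_A (`IsErrorMatrix.aubin_nitsche`).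

The operator E enters only through ‖Eu‖ ≤ h‖(Eu)'‖ and ‖(Eu)'‖² = ((Eu)', u'). Cauchy-Schwarz gives
‖(Eu)'‖ ≤ ‖u'‖. With the discrete Laplacian L it also gives ‖(Eu)'‖² ≤ ‖Eu‖‖Lu‖, hence ‖(Eu)'‖ ≤
h‖Lu‖ (`IsEigenbasis.isErrorMatrix`).

The inequality ‖Eu‖ ≤ h‖(Eu)'‖, with a constant free of p, rests on a ladder of spline spaces X_p,
Y_p in which odd, respectively even, derivatives vanish at the ends. Integration takes Y_p into
X_{p+1} and the mean-free part of X_p into Y_{p+1}. Approximation of primitives with constant h is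
elementary for piecewise constants. A duality step passes it from degree p to p + 1 with the same
constant (`exists_ladder_approx`). Since (Eu)' is orthogonal to Y_{p-1}, one more duality step
bounds Eu (`massForm_le_stiffForm`). -/

namespace SplineMG

/-! ### Semidefinite forms: projectors, duality, simultaneous diagonalization -/

section Form

variable {V : Type*} [AddCommGroup V] [Module ℝ V]

/-- A symmetric positive semidefinite bilinear form on a real vector space. -/
structure IsPSDForm (B : V →ₗ[ℝ] V →ₗ[ℝ] ℝ) : Prop where
  symm : ∀ x y, B x y = B y x
  nonneg : ∀ x, 0 ≤ B x x

namespace IsPSDForm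

variable {B : V →ₗ[ℝ] V →ₗ[ℝ] ℝ}

theorem cauchy_schwarz (hB : IsPSDForm B) (x y : V) : B x y ^ 2 ≤ B x x * B y y :=
  LinearMap.BilinForm.apply_sq_le_of_symm B hB.nonneg ⟨fun x y => hB.symm x y⟩ x y

theorem apply_eq_zero (hB : IsPSDForm B) {x : V} (hx : B x x = 0) (y : V) : B x y = 0 := by
  have := hB.cauchy_schwarz x y
  rw [hx, zero_mul] at this
  exact pow_eq_zero_iff (two_ne_zero) |>.1 (le_antisymm this (sq_nonneg _))

/-- Gram-Schmidt, adding one generator at a time. Semidefiniteness is enough because a vector of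
zero length is orthogonal to everything. -/
theorem exists_sub_orthogonal (hB : IsPSDForm B) (s : Finset V) (g : V) :
    ∃ x ∈ Submodule.span ℝ (s : Set V), ∀ w ∈ Submodule.span ℝ (s : Set V), B (g - x) w = 0 := by
  classical
  induction s using Finset.induction_on generalizing g with
  | empty => exact ⟨0, Submodule.zero_mem _, by simp⟩
  | insert b s _ ih =>
    obtain ⟨b', hb', hbo⟩ := ih b
    obtain ⟨x, hx, hxo⟩ := ih g
    have hle : Submodule.span ℝ (s : Set V) ≤ Submodule.span ℝ ((insert b s : Finset V) : Set V) :=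
      Submodule.span_mono (by simp)
    have hb : b ∈ Submodule.span ℝ ((insert b s : Finset V) : Set V) :=
      Submodule.subset_span (by simp)
    set t : ℝ := B (g - x) (b - b') / B (b - b') (b - b') with ht
    refine ⟨x + t • (b - b'), add_mem (hle hx)
      (Submodule.smul_mem _ _ (sub_mem hb (hle hb'))), fun w hw => ?_⟩
    have hsub : g - (x + t • (b - b')) = g - x - t • (b - b') := by abel
    have hs : ∀ w ∈ Submodule.span ℝ (s : Set V), B (g - (x + t • (b - b'))) w = 0 := by
      intro w hw
      rw [hsub, map_sub, map_smul, LinearMap.sub_apply, LinearMap.smul_apply, hxo w hw, hbo w hw]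
      simp
    have hbb : B (g - (x + t • (b - b'))) (b - b') = 0 := by
      rw [hsub, map_sub B, map_smul B, LinearMap.sub_apply, LinearMap.smul_apply, smul_eq_mul]
      -- In the degenerate case b - b' lies in the kernel of the form, so the value of the quotient
      -- t is irrelevant.
      by_cases h0 : B (b - b') (b - b') = 0
      · rw [hB.symm, hB.apply_eq_zero h0, h0]; simp
      · rw [ht]; field_simp; ring
    rw [Finset.coe_insert, Submodule.mem_span_insert] at hw
    obtain ⟨a, z, hz, rfl⟩ := hw
    have : a • b + z = a • (b - b') + (a • b' + z) := by rw [smul_sub]; abel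
    rw [this, map_add, map_smul, hbb, hs _ (add_mem (Submodule.smul_mem _ _ hb') hz)]
    simp

/-- Orthogonal projectors onto finite-dimensional subspaces exist for semidefinite forms. -/
theorem exists_projector (hB : IsPSDForm B) (W : Submodule ℝ V) [FiniteDimensional ℝ W] :
    ∃ Q : V →ₗ[ℝ] V, (∀ g, Q g ∈ W) ∧ ∀ g, ∀ w ∈ W, B (g - Q g) w = 0 := by
  obtain ⟨s, hs⟩ := (Submodule.fg_iff_finiteDimensional W).2 inferInstance
  have h : ∀ g, ∃ x ∈ W, ∀ w ∈ W, B (g - x) w = 0 := hs ▸ hB.exists_sub_orthogonal s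
  choose q hqW hq using h
  -- The chosen projections need not depend linearly on g when the form is degenerate. They are
  -- therefore kept only on a basis and extended linearly; both required properties are linear in g.
  let b := Module.Basis.ofVectorSpace ℝ V
  let Q : V →ₗ[ℝ] V := b.constr ℝ fun i => q (b i)
  have hQ : ∀ i, Q (b i) = q (b i) := fun i => b.constr_basis ℝ _ i
  refine ⟨Q, fun g => ?_, fun g w hw => ?_⟩
  · have : g ∈ Submodule.comap Q W := by
      have hle : (⊤ : Submodule ℝ V) ≤ Submodule.comap Q W := by
        rw [← b.span_eq, Submodule.span_le]
        rintro _ ⟨i, rfl⟩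
        simpa [hQ] using hqW (b i)
      exact hle trivial
    exact this
  · have : (B.flip w ∘ₗ (LinearMap.id - Q)) = 0 :=
      b.ext fun i => by simpa [hQ] using hq (b i) w hw
    simpa using LinearMap.congr_fun this g

theorem sub_projector_le (hB : IsPSDForm B) {W : Submodule ℝ V} {g x : V} (hx : x ∈ W)
    (ho : ∀ w ∈ W, B (g - x) w = 0) : B (g - x) (g - x) ≤ B g g := by
  have h1 := ho x hx
  have h2 : B g g = B (g - x) (g - x) + 2 * B (g - x) x + B x x := by
    simp only [map_sub, LinearMap.sub_apply, hB.symm x g]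
    ring
  have := hB.nonneg x
  linarith

/-- The duality argument: if `B f f` can be tested against the potential `I f`, whose distance to
`W` is controlled by `f`, and `r` is orthogonal to `W`, then `f` is controlled by `r`. -/
theorem duality (hB : IsPSDForm B) {W : Submodule ℝ V} {f r v : V} {C : ℝ}
    (hC : 0 ≤ C) (hf : B f f = -B r v) (hr : ∀ w ∈ W, B r w = 0)
    (hv : ∃ y ∈ W, B (v - y) (v - y) ≤ C * B f f) : B f f ≤ C * B r r := by
  obtain ⟨y, hy, hvy⟩ := hv
  have h1 : B f f = -B r (v - y) := by rw [hf, map_sub, hr y hy, sub_zero]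
  have h2 := hB.cauchy_schwarz r (v - y)
  -- Cauchy-Schwarz leaves one factor B f f on the right, which is cancelled unless it is zero.
  have h3 : B f f ^ 2 ≤ B r r * (C * B f f) := by
    rw [h1, neg_sq, ← h1]
    exact h2.trans (mul_le_mul_of_nonneg_left hvy (hB.nonneg r))
  rcases (hB.nonneg f).eq_or_lt with h0 | h0
  · rw [← h0]; exact mul_nonneg hC (hB.nonneg r)
  · nlinarith

/-- Simultaneous diagonalization of a positive definite and a positive semidefinite form. -/
theorem exists_eigenbasis [FiniteDimensional ℝ V] {m k : V →ₗ[ℝ] V →ₗ[ℝ] ℝ} (hm : IsPSDForm m)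
    (hm0 : ∀ x, m x x = 0 → x = 0) (hk : IsPSDForm k) :
    ∃ (φ : Module.Basis (Fin (Module.finrank ℝ V)) ℝ V) (μ : Fin (Module.finrank ℝ V) → ℝ),
      (∀ i, 0 ≤ μ i) ∧ (∀ i j, m (φ i) (φ j) = if i = j then 1 else 0) ∧
      ∀ i j, k (φ i) (φ j) = if i = j then μ i else 0 := by
  let core : InnerProductSpace.Core ℝ V :=
    { inner := fun x y => m x y
      conj_inner_symm := fun x y => hm.symm y x
      re_inner_nonneg := hm.nonneg
      add_left := by simp
      smul_left := by simp
      definite := hm0 }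
  let _ : NormedAddCommGroup V := core.toNormedAddCommGroup
  let _ : InnerProductSpace ℝ V := InnerProductSpace.ofCore core.toCore
  have hinner : ∀ x y : V, inner ℝ x y = m x y := fun _ _ => rfl
  let L : V →ₗ[ℝ] V :=
    { toFun := fun x => (InnerProductSpace.toDual ℝ V).symm (LinearMap.toContinuousLinearMap (k x))
      map_add' := by simp
      map_smul' := by simp }
  have hL : ∀ x y, m (L x) y = k x y := fun x y => by
    rw [← hinner]
    simp [L]
  have hsymm : L.IsSymmetric := fun x y => by
    rw [hinner, hinner, hL, hm.symm, hL, hk.symm]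
  let b := hsymm.eigenvectorBasis rfl
  have hbb : ∀ i j, m (b i) (b j) = if i = j then 1 else 0 := fun i j => by
    rw [← hinner]
    exact orthonormal_iff_ite.1 b.orthonormal i j
  have hkb : ∀ i j, k (b i) (b j) = if i = j then hsymm.eigenvalues rfl i else 0 := fun i j => by
    rw [← hL, hsymm.apply_eigenvectorBasis rfl i, ← hinner, inner_smul_left, hinner, hbb]
    simp
  refine ⟨b.toBasis, hsymm.eigenvalues rfl, fun i => ?_, by simpa using hbb, by simpa using hkb⟩
  have := hk.nonneg (b i)
  rwa [hkb, if_pos rfl] at this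

end IsPSDForm

/-! ### The abstract ladder of spaces and its degree-independent approximation constant -/

section Ladder

variable (B : V →ₗ[ℝ] V →ₗ[ℝ] ℝ) (I : V →ₗ[ℝ] V) (e : V) (X₀ : Submodule ℝ V)

/-- Starting from one space, alternately integrate with a free constant of integration (first
component) and under homogeneous boundary conditions (second component). -/
def ladder : ℕ → Submodule ℝ V × Submodule ℝ V
  | 0 => (X₀, X₀)
  | p + 1 => (Submodule.span ℝ {e} ⊔ (ladder p).2.map I,
      ((ladder p).1 ⊓ LinearMap.ker (B e)).map I)

theorem ladder_finiteDimensional [FiniteDimensional ℝ X₀] (p : ℕ) :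
    FiniteDimensional ℝ (ladder B I e X₀ p).1 ∧ FiniteDimensional ℝ (ladder B I e X₀ p).2 := by
  induction p with
  | zero => exact ⟨‹_›, ‹_›⟩
  | succ p ih =>
    obtain ⟨h1, h2⟩ := ih
    constructor
    · rw [ladder]; infer_instance
    · rw [ladder]
      have : FiniteDimensional ℝ ((ladder B I e X₀ p).1 ⊓ LinearMap.ker (B e) : Submodule ℝ V) :=
        Submodule.finiteDimensional_inf_left _ _
      infer_instance

variable {B I e X₀}

theorem mem_ladder (he : e ∈ X₀) (p : ℕ) : e ∈ (ladder B I e X₀ p).1 := by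
  cases p with
  | zero => exact he
  | succ p => exact Submodule.mem_sup_left (Submodule.mem_span_singleton_self e)

/-- Think of I as integration from 0 and e as the constant 1; `hI` is then integration by parts. The
two claims feed each other. The residual r of a projection at level p is orthogonal to one space,
its primitive is the error at level p + 1, and the primitive of that error is approximable at level
p by the induction hypothesis. `duality` then returns the same C, because projecting does not
increase B g g. -/
theorem exists_ladder_approx [FiniteDimensional ℝ X₀] (hB : IsPSDForm B) {C : ℝ} (hC : 0 ≤ C)
    (he : e ∈ X₀) (hee : B e e = 1)
    (hI : ∀ f g, B (I f) g + B f (I g) = B f e * B g e)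
    (h0 : ∀ (c : ℝ) g, ∃ s ∈ X₀, B (c • e + I g - s) (c • e + I g - s) ≤ C * B g g) (p : ℕ) :
    (∀ (c : ℝ) g, ∃ s ∈ (ladder B I e X₀ p).1, B (c • e + I g - s) (c • e + I g - s) ≤ C * B g g) ∧
    ∀ g, B e g = 0 → ∃ s ∈ (ladder B I e X₀ p).2, B (I g - s) (I g - s) ≤ C * B g g := by
  induction p with
  | zero => exact ⟨h0, fun g _ => by
    have := h0 0 g
    rwa [zero_smul, zero_add] at this⟩
  | succ p ih =>
    obtain ⟨ihX, ihY⟩ := ih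
    obtain ⟨hfX, hfY⟩ := ladder_finiteDimensional B I e X₀ p
    obtain ⟨P, hP, hPo⟩ := hB.exists_projector (ladder B I e X₀ p).1
    obtain ⟨Q, hQ, hQo⟩ := hB.exists_projector (ladder B I e X₀ p).2
    constructor
    · intro c g
      set r := g - Q g with hr
      set t := B (I r) e with ht
      set f := I r - t • e with hf
      have hfe : B f e = 0 := by
        simp [hf, ht, hee]
      -- Subtracting the mean makes f orthogonal to e. This removes the boundary term and also makes
      -- the mean-free half of the induction hypothesis applicable to f.
      have hff : B f f = -B r (I f) := by
        have h1 := hI r f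
        rw [hfe, mul_zero] at h1
        have h2 : B f f = B (I r) f - t * B e f := by
          conv_lhs => rw [hf, map_sub B, map_smul B, LinearMap.sub_apply, LinearMap.smul_apply,
            smul_eq_mul, ← hf]
        rw [h2, hB.symm e, hfe]
        linarith
      have key := hB.duality hC hff (hQo g) (ihY f (by rw [hB.symm, hfe]))
      -- The free constant of integration absorbs the mean t of I r.
      refine ⟨(c + t) • e + I (Q g), add_mem (Submodule.mem_sup_left
        (Submodule.smul_mem _ _ (Submodule.mem_span_singleton_self e)))
        (Submodule.mem_sup_right ⟨_, hQ g, rfl⟩), ?_⟩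
      have : c • e + I g - ((c + t) • e + I (Q g)) = f := by
        rw [hf, hr, map_sub, add_smul]; abel
      rw [this]
      exact key.trans (mul_le_mul_of_nonneg_left (hB.sub_projector_le (hQ g) (hQo g)) hC)
    · intro g hg
      set r := g - P g with hr
      -- Since e belongs to the space projected onto, the projection preserves the mean. Hence P g
      -- may be integrated into the second component, and the boundary term vanishes.
      have hre : B r e = 0 := hPo g e (mem_ladder he p)
      have hPe : B e (P g) = 0 := by
        have : B e r = 0 := by rw [hB.symm, hre]
        rw [hr, map_sub, hg] at this
        linarith
      have hff : B (I r) (I r) = -B r (I (I r)) := by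
        have h1 := hI r (I r)
        rw [hre, zero_mul] at h1
        linarith
      have key := hB.duality hC hff (hPo g) (by simpa using ihX 0 (I r))
      refine ⟨I (P g), ⟨_, ⟨hP g, hPe⟩, rfl⟩, ?_⟩
      rw [← map_sub, ← hr]
      exact key.trans (mul_le_mul_of_nonneg_left (hB.sub_projector_le (hP g) (hPo g)) hC)

end Ladder

end Form

/-! ### Aubin-Nitsche in eigenbasis coordinates -/

section TensorEstimate

open Matrix

variable {ι : Type*} [Fintype ι] {μ : ι → ℝ} {E : Matrix ι ι ℝ} {h : ℝ}

/-- The energy of a coefficient matrix with respect to the tensor products of eigenfunctions. -/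
def matEnergy (μ : ι → ℝ) (U V : Matrix ι ι ℝ) : ℝ :=
  ∑ i, ∑ j, (1 + μ i + μ j) * (U i j * V i j)

/-- The estimates which an error operator `E` satisfies with respect to an eigenbasis: approximation
in `L²`, stability in `H¹`, approximation in `H¹`. -/
structure IsErrorMatrix (μ : ι → ℝ) (h : ℝ) (E : Matrix ι ι ℝ) : Prop where
  l2_le : ∀ a, ∑ i, (E *ᵥ a) i ^ 2 ≤ h ^ 2 * ∑ i, μ i * (E *ᵥ a) i ^ 2
  stable : ∀ a, ∑ i, μ i * (E *ᵥ a) i ^ 2 ≤ ∑ i, μ i * a i ^ 2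
  h1_le : ∀ a, ∑ i, μ i * (E *ᵥ a) i ^ 2 ≤ h ^ 2 * ∑ i, μ i ^ 2 * a i ^ 2

theorem matEnergy_transpose (U V : Matrix ι ι ℝ) :
    matEnergy μ Uᵀ Vᵀ = matEnergy μ U V := by
  rw [matEnergy, Finset.sum_comm]
  refine Finset.sum_congr rfl fun i _ => Finset.sum_congr rfl fun j _ => ?_
  simp only [transpose_apply]
  ring

/-- E acts on each column separately, so a column is a univariate problem with the parameter 1 +
μ_j. The H¹ estimate handles the weight μ_i; the L² estimate followed by stability handles 1 + μ_j.
-/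
theorem IsErrorMatrix.energy_mul_le (hE : IsErrorMatrix μ h E) (hμ : ∀ i, 0 ≤ μ i)
    (Z : Matrix ι ι ℝ) : matEnergy μ (E * Z) (E * Z) ≤
      h ^ 2 * ∑ i, ∑ j, (1 + μ i + μ j) ^ 2 * Z i j ^ 2 := by
  rw [matEnergy, Finset.sum_comm, Finset.sum_comm (γ := ι) (s := Finset.univ)
    (f := fun i j => (1 + μ i + μ j) ^ 2 * Z i j ^ 2), Finset.mul_sum]
  refine Finset.sum_le_sum fun j _ => ?_
  set a : ι → ℝ := fun k => Z k j
  have hEa : ∀ i, (E * Z) i j = (E *ᵥ a) i := fun i => rfl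
  simp only [hEa]
  have h1 := hE.l2_le a
  have h2 := hE.stable a
  have h3 := hE.h1_le a
  have h4 : ∑ i, (1 + μ i + μ j) * ((E *ᵥ a) i * (E *ᵥ a) i) =
      ∑ i, μ i * (E *ᵥ a) i ^ 2 + (1 + μ j) * ∑ i, (E *ᵥ a) i ^ 2 := by
    rw [Finset.mul_sum, ← Finset.sum_add_distrib]
    exact Finset.sum_congr rfl fun i _ => by ring
  have h5 : ∑ i, (E *ᵥ a) i ^ 2 ≤ h ^ 2 * ∑ i, μ i * a i ^ 2 :=
    h1.trans (mul_le_mul_of_nonneg_left h2 (sq_nonneg h))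
  calc _ = _ := h4
    _ ≤ h ^ 2 * ∑ i, μ i ^ 2 * a i ^ 2 + (1 + μ j) * (h ^ 2 * ∑ i, μ i * a i ^ 2) :=
        add_le_add h3 (mul_le_mul_of_nonneg_left h5 (by linarith [hμ j]))
    _ = h ^ 2 * ∑ i, (μ i ^ 2 + (1 + μ j) * μ i) * a i ^ 2 := by
        simp only [Finset.mul_sum, ← Finset.sum_add_distrib]
        exact Finset.sum_congr rfl fun i _ => by ring
    _ ≤ _ := by
        refine mul_le_mul_of_nonneg_left (Finset.sum_le_sum fun i _ => ?_) (sq_nonneg h)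
        refine mul_le_mul_of_nonneg_right ?_ (sq_nonneg _)
        nlinarith [hμ i, hμ j, mul_nonneg (hμ i) (hμ j)]

theorem IsErrorMatrix.energy_mul_transpose_le (hE : IsErrorMatrix μ h E) (hμ : ∀ i, 0 ≤ μ i)
    (Z : Matrix ι ι ℝ) : matEnergy μ (Z * Eᵀ) (Z * Eᵀ) ≤
      h ^ 2 * ∑ i, ∑ j, (1 + μ i + μ j) ^ 2 * Z i j ^ 2 := by
  rw [← matEnergy_transpose, transpose_mul, transpose_transpose]
  refine (hE.energy_mul_le hμ Zᵀ).trans_eq ?_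
  rw [Finset.sum_comm]
  congr 1
  refine Finset.sum_congr rfl fun i _ => Finset.sum_congr rfl fun j _ => ?_
  simp only [transpose_apply]
  ring

/-- Stability and the L² estimate are applied first in the columns, then in the rows. The outcome is
a multiple of μ_i μ_j, the square of the mixed derivative, which the squared energy weight
dominates. The condition h² ≤ 1 turns 2h² + h⁴ into 3h². -/
theorem IsErrorMatrix.energy_mul_mul_le (hE : IsErrorMatrix μ h E) (hμ : ∀ i, 0 ≤ μ i)
    (h1 : h ^ 2 ≤ 1) (Z : Matrix ι ι ℝ) : matEnergy μ (E * (Z * Eᵀ)) (E * (Z * Eᵀ)) ≤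
      2 * (h ^ 2 * ∑ i, ∑ j, (1 + μ i + μ j) ^ 2 * Z i j ^ 2) := by
  set W := Z * Eᵀ with hW
  have hWr : ∀ i j, W i j = (E *ᵥ (Z i)) j := fun i j => by
    simp [hW, Matrix.mul_apply, mulVec, dotProduct, mul_comm]
  have hcol : ∀ j, ∑ i, (1 + μ i + μ j) * ((E * W) i j * (E * W) i j) ≤
      ∑ i, (1 + h ^ 2 * (1 + μ j)) * (μ i * W i j ^ 2) := fun j => by
    set a : ι → ℝ := fun k => W k j
    have hEa : ∀ i, (E * W) i j = (E *ᵥ a) i := fun i => rfl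
    simp only [hEa]
    have h2 := hE.stable a
    have h5 : ∑ i, (E *ᵥ a) i ^ 2 ≤ h ^ 2 * ∑ i, μ i * a i ^ 2 :=
      (hE.l2_le a).trans (mul_le_mul_of_nonneg_left h2 (sq_nonneg h))
    have h4 : ∑ i, (1 + μ i + μ j) * ((E *ᵥ a) i * (E *ᵥ a) i) =
        ∑ i, μ i * (E *ᵥ a) i ^ 2 + (1 + μ j) * ∑ i, (E *ᵥ a) i ^ 2 := by
      rw [Finset.mul_sum, ← Finset.sum_add_distrib]
      exact Finset.sum_congr rfl fun i _ => by ring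
    have h6 := mul_le_mul_of_nonneg_left h5 (by linarith [hμ j] : 0 ≤ 1 + μ j)
    rw [h4, ← Finset.mul_sum]
    change _ ≤ (1 + h ^ 2 * (1 + μ j)) * ∑ i, μ i * a i ^ 2
    linarith
  have hrow : ∀ i, ∑ j, (1 + h ^ 2 * (1 + μ j)) * (μ i * W i j ^ 2) ≤
      ∑ j, (3 * h ^ 2 * (μ i * μ j)) * Z i j ^ 2 := fun i => by
    have h2 := hE.stable (Z i)
    have h5 : ∑ j, (E *ᵥ (Z i)) j ^ 2 ≤ h ^ 2 * ∑ j, μ j * Z i j ^ 2 :=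
      (hE.l2_le _).trans (mul_le_mul_of_nonneg_left h2 (sq_nonneg h))
    have h6 : ∑ j, (1 + h ^ 2 * (1 + μ j)) * (μ i * W i j ^ 2) =
        μ i * ((1 + h ^ 2) * ∑ j, (E *ᵥ (Z i)) j ^ 2 +
          h ^ 2 * ∑ j, μ j * (E *ᵥ (Z i)) j ^ 2) := by
      simp only [Finset.mul_sum, ← Finset.sum_add_distrib, hWr]
      exact Finset.sum_congr rfl fun j _ => by ring
    have h7 : ∑ j, (3 * h ^ 2 * (μ i * μ j)) * Z i j ^ 2 =
        μ i * (3 * (h ^ 2 * ∑ j, μ j * Z i j ^ 2)) := by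
      simp only [Finset.mul_sum]
      exact Finset.sum_congr rfl fun j _ => by ring
    rw [h6, h7]
    refine mul_le_mul_of_nonneg_left ?_ (hμ i)
    have h8 : 0 ≤ ∑ j, (E *ᵥ (Z i)) j ^ 2 := Finset.sum_nonneg fun j _ => sq_nonneg _
    have h9 := mul_le_mul_of_nonneg_left h2 (sq_nonneg h)
    have h10 := mul_le_mul_of_nonneg_right h1 h8
    linarith
  calc _ = ∑ j, ∑ i, (1 + μ i + μ j) * ((E * W) i j * (E * W) i j) := Finset.sum_comm
    _ ≤ ∑ j, ∑ i, (1 + h ^ 2 * (1 + μ j)) * (μ i * W i j ^ 2) :=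
        Finset.sum_le_sum fun j _ => hcol j
    _ = ∑ i, ∑ j, (1 + h ^ 2 * (1 + μ j)) * (μ i * W i j ^ 2) := Finset.sum_comm
    _ ≤ ∑ i, ∑ j, (3 * h ^ 2 * (μ i * μ j)) * Z i j ^ 2 := Finset.sum_le_sum fun i _ => hrow i
    _ ≤ ∑ i, ∑ j, 2 * (h ^ 2 * ((1 + μ i + μ j) ^ 2 * Z i j ^ 2)) := by
        refine Finset.sum_le_sum fun i _ => Finset.sum_le_sum fun j _ => ?_
        have : 3 * (μ i * μ j) ≤ 2 * (1 + μ i + μ j) ^ 2 := by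
          nlinarith [hμ i, hμ j, mul_nonneg (hμ i) (hμ j)]
        nlinarith [mul_le_mul_of_nonneg_right this (mul_nonneg (sq_nonneg h) (sq_nonneg (Z i j)))]
    _ = _ := by simp only [Finset.mul_sum]

/-- The energy scalar product of coefficient matrices as a bilinear form. -/
def matEnergyForm (μ : ι → ℝ) : Matrix ι ι ℝ →ₗ[ℝ] Matrix ι ι ℝ →ₗ[ℝ] ℝ :=
  LinearMap.mk₂ ℝ (matEnergy μ)
    (fun U U' V => by
      simp only [matEnergy, ← Finset.sum_add_distrib, Matrix.add_apply, add_mul, mul_add])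
    (fun c U V => by
      simp only [matEnergy, Finset.mul_sum, Matrix.smul_apply, smul_eq_mul]
      exact Finset.sum_congr rfl fun i _ => Finset.sum_congr rfl fun j _ => by ring)
    (fun U V V' => by
      simp only [matEnergy, ← Finset.sum_add_distrib, Matrix.add_apply, mul_add])
    (fun c U V => by
      simp only [matEnergy, Finset.mul_sum, Matrix.smul_apply, smul_eq_mul]
      exact Finset.sum_congr rfl fun i _ => Finset.sum_congr rfl fun j _ => by ring)

theorem matEnergyForm_apply (U V : Matrix ι ι ℝ) : matEnergyForm μ U V = matEnergy μ U V := rfl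

theorem isPSDForm_matEnergyForm (hμ : ∀ i, 0 ≤ μ i) : IsPSDForm (matEnergyForm μ) where
  symm U V := by
    simp only [matEnergyForm_apply, matEnergy, mul_comm (U _ _)]
  nonneg U := Finset.sum_nonneg fun i _ => Finset.sum_nonneg fun j _ =>
    mul_nonneg (by linarith [hμ i, hμ j]) (mul_self_nonneg _)

theorem matEnergy_definite (hμ : ∀ i, 0 ≤ μ i) {U : Matrix ι ι ℝ} (hU : matEnergy μ U U = 0) :
    U = 0 := by
  have hpos : ∀ i j, 0 < 1 + μ i + μ j := fun i j => by linarith [hμ i, hμ j]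
  have h0 : ∀ i j, 0 ≤ (1 + μ i + μ j) * (U i j * U i j) := fun i j =>
    mul_nonneg (hpos i j).le (mul_self_nonneg _)
  ext i j
  have h1 := (Finset.sum_eq_zero_iff_of_nonneg fun i _ =>
    Finset.sum_nonneg fun j _ => h0 i j).1 hU i (Finset.mem_univ i)
  have h2 := (Finset.sum_eq_zero_iff_of_nonneg fun j _ => h0 i j).1 h1 j (Finset.mem_univ j)
  simpa [(hpos i j).ne'] using h2

/-- With P = 1 - E one has 1 - P⊗P = E⊗1 + 1⊗E - E⊗E, and each term has been estimated. -/
theorem IsErrorMatrix.energy_sub_le [DecidableEq ι] (hE : IsErrorMatrix μ h E)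
    (hμ : ∀ i, 0 ≤ μ i) (h1 : h ^ 2 ≤ 1) (Z : Matrix ι ι ℝ) :
    matEnergy μ (Z - (1 - E) * Z * (1 - E)ᵀ) (Z - (1 - E) * Z * (1 - E)ᵀ) ≤
      16 * (h ^ 2 * ∑ i, ∑ j, (1 + μ i + μ j) ^ 2 * Z i j ^ 2) := by
  have hsplit : Z - (1 - E) * Z * (1 - E)ᵀ = E * Z + Z * Eᵀ - E * (Z * Eᵀ) := by
    rw [transpose_sub, transpose_one]
    noncomm_ring
  rw [hsplit]
  have hA := hE.energy_mul_le hμ Z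
  have hB := hE.energy_mul_transpose_le hμ Z
  have hC := hE.energy_mul_mul_le hμ h1 Z
  have hN : 0 ≤ h ^ 2 * ∑ i, ∑ j, (1 + μ i + μ j) ^ 2 * Z i j ^ 2 :=
    mul_nonneg (sq_nonneg h) (Finset.sum_nonneg fun i _ => Finset.sum_nonneg fun j _ => by positivity)
  have h3 : ∀ A B C : Matrix ι ι ℝ, matEnergy μ (A + B - C) (A + B - C) ≤
      3 * matEnergy μ A A + 3 * matEnergy μ B B + 3 * matEnergy μ C C := fun A B C => by
    simp only [matEnergy, Finset.mul_sum, ← Finset.sum_add_distrib]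
    refine Finset.sum_le_sum fun i _ => Finset.sum_le_sum fun j _ => ?_
    simp only [Matrix.add_apply, Matrix.sub_apply]
    have hw : 0 ≤ 1 + μ i + μ j := by linarith [hμ i, hμ j]
    have : (A i j + B i j - C i j) * (A i j + B i j - C i j) ≤
        3 * (A i j * A i j) + 3 * (B i j * B i j) + 3 * (C i j * C i j) := by
      nlinarith [sq_nonneg (A i j - B i j), sq_nonneg (A i j + C i j), sq_nonneg (B i j + C i j)]
    nlinarith [mul_le_mul_of_nonneg_left this hw]
  -- The sum is 3(1 + 1 + 2) = 12, rounded up to the square 16.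
  linarith [h3 (E * Z) (Z * Eᵀ) (E * (Z * Eᵀ))]

/-- The Aubin-Nitsche argument in coordinates: a matrix which is energy orthogonal to all
`P Z Pᵀ` with `P = 1 - E` is small in `L²` relative to its energy. -/
theorem IsErrorMatrix.aubin_nitsche [DecidableEq ι] (hE : IsErrorMatrix μ h E)
    (hμ : ∀ i, 0 ≤ μ i) (h1 : h ^ 2 ≤ 1) (D : Matrix ι ι ℝ)
    (hD : ∀ Z, matEnergy μ D ((1 - E) * Z * (1 - E)ᵀ) = 0) :
    ∑ i, ∑ j, D i j ^ 2 ≤ 16 * h ^ 2 * matEnergy μ D D := by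
  -- The exact solution of the discrete dual problem with right-hand side D.
  set Z : Matrix ι ι ℝ := Matrix.of fun i j => D i j / (1 + μ i + μ j) with hZ
  have hpos : ∀ i j, 0 < 1 + μ i + μ j := fun i j => by linarith [hμ i, hμ j]
  have hZD : ∀ i j, (1 + μ i + μ j) * Z i j = D i j := fun i j => by
    rw [hZ, Matrix.of_apply, mul_div_cancel₀ _ (hpos i j).ne']
  set s := ∑ i, ∑ j, D i j ^ 2 with hs
  have hs0 : 0 ≤ s := Finset.sum_nonneg fun i _ => Finset.sum_nonneg fun j _ => sq_nonneg _
  have hsZ : ∑ i, ∑ j, (1 + μ i + μ j) ^ 2 * Z i j ^ 2 = s :=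
    Finset.sum_congr rfl fun i _ => Finset.sum_congr rfl fun j _ => by rw [← mul_pow, hZD]
  have hsE : s = matEnergy μ D (Z - (1 - E) * Z * (1 - E)ᵀ) := by
    have h2 : matEnergy μ D (Z - (1 - E) * Z * (1 - E)ᵀ) =
        matEnergy μ D Z - matEnergy μ D ((1 - E) * Z * (1 - E)ᵀ) := by
      simp only [matEnergy, ← Finset.sum_sub_distrib, Matrix.sub_apply]
      exact Finset.sum_congr rfl fun i _ => Finset.sum_congr rfl fun j _ => by ring
    rw [h2, hD, sub_zero]
    refine Finset.sum_congr rfl fun i _ => Finset.sum_congr rfl fun j _ => ?_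
    rw [← hZD i j]; ring
  have hDD : 0 ≤ matEnergy μ D D := Finset.sum_nonneg fun i _ => Finset.sum_nonneg fun j _ =>
    mul_nonneg (hpos i j).le (mul_self_nonneg _)
  have h2 := (isPSDForm_matEnergyForm hμ).cauchy_schwarz D (Z - (1 - E) * Z * (1 - E)ᵀ)
  simp only [matEnergyForm_apply, ← hsE] at h2
  have h3 := mul_le_mul_of_nonneg_left (hE.energy_sub_le hμ h1 Z) hDD
  rw [hsZ] at h3
  rcases hs0.eq_or_lt with h0 | h0
  · rw [← h0]; positivity
  · nlinarith

end TensorEstimate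

/-! ### Piecewise continuous functions, their primitives, and piecewise constant approximation -/

/-- The algebra of functions which are locally bounded and continuous off a finite set. -/
def pwAlg : Subalgebra ℝ (ℝ → ℝ) where
  carrier := {g | ∃ N : Set ℝ, N.Finite ∧ (∀ x ∉ N, ContinuousAt g x) ∧
    ∀ R : ℝ, ∃ M : ℝ, ∀ x, |x| ≤ R → x ∉ N → |g x| ≤ M}
  mul_mem' := by
    rintro f g ⟨N, hN, hNc, hNb⟩ ⟨N', hN', hNc', hNb'⟩
    refine ⟨N ∪ N', hN.union hN', fun x hx => ?_, fun R => ?_⟩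
    · exact (hNc x fun h => hx (Or.inl h)).mul (hNc' x fun h => hx (Or.inr h))
    · obtain ⟨M, hM⟩ := hNb R
      obtain ⟨M', hM'⟩ := hNb' R
      refine ⟨M * M', fun x hx hxN => ?_⟩
      have h1 := hM x hx fun h => hxN (Or.inl h)
      have h2 := hM' x hx fun h => hxN (Or.inr h)
      rw [Pi.mul_apply, abs_mul]
      exact mul_le_mul h1 h2 (abs_nonneg _) ((abs_nonneg _).trans h1)
  add_mem' := by
    rintro f g ⟨N, hN, hNc, hNb⟩ ⟨N', hN', hNc', hNb'⟩
    refine ⟨N ∪ N', hN.union hN', fun x hx => ?_, fun R => ?_⟩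
    · exact (hNc x fun h => hx (Or.inl h)).add (hNc' x fun h => hx (Or.inr h))
    · obtain ⟨M, hM⟩ := hNb R
      obtain ⟨M', hM'⟩ := hNb' R
      refine ⟨M + M', fun x hx hxN => ?_⟩
      exact (abs_add_le _ _).trans (add_le_add (hM x hx fun h => hxN (Or.inl h))
        (hM' x hx fun h => hxN (Or.inr h)))
  algebraMap_mem' c := by
    refine ⟨∅, finite_empty, fun x _ => ?_, fun R => ⟨|c|, fun x _ _ => ?_⟩⟩
    · exact continuousAt_const (y := c)
    · exact le_rfl

theorem pwAlg_congr {f g : ℝ → ℝ} {N : Set ℝ} (hN : N.Finite) (hg : g ∈ pwAlg)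
    (hfg : ∀ x ∉ N, f x = g x) : f ∈ pwAlg := by
  obtain ⟨N', hN', hc, hb⟩ := hg
  refine ⟨N ∪ N', hN.union hN', fun x hx => ?_, fun R => ?_⟩
  · refine (hc x fun h => hx (Or.inr h)).congr ?_
    filter_upwards [hN.isClosed.isOpen_compl.mem_nhds fun h => hx (Or.inl h)] with y hy
    exact (hfg y hy).symm
  · obtain ⟨M, hM⟩ := hb R
    refine ⟨M, fun x hx hxN => ?_⟩
    rw [hfg x fun h => hxN (Or.inl h)]
    exact hM x hx fun h => hxN (Or.inr h)

theorem pwAlg_of_continuous {f : ℝ → ℝ} (hf : Continuous f) : f ∈ pwAlg := by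
  refine ⟨∅, finite_empty, fun x _ => hf.continuousAt, fun R => ?_⟩
  obtain ⟨M, hM⟩ := (isCompact_Icc (a := -R) (b := R)).exists_bound_of_continuousOn hf.continuousOn
  exact ⟨M, fun x hx _ => hM x (abs_le.1 hx)⟩

theorem pwAlg_indicator_Ioo (a b : ℝ) : (Ioo a b).indicator (1 : ℝ → ℝ) ∈ pwAlg := by
  refine ⟨{a, b}, by simp, fun x hx => ?_, fun R => ⟨1, fun x _ _ => ?_⟩⟩
  · by_cases h : x ∈ Ioo a b
    · refine (continuousAt_const (y := (1 : ℝ))).congr ?_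
      filter_upwards [isOpen_Ioo.mem_nhds h] with y hy
      simp [hy]
    · refine (continuousAt_const (y := (0 : ℝ))).congr ?_
      have hx' : x ∈ (Icc a b)ᶜ := fun h' => by
        simp only [mem_insert_iff, mem_singleton_iff, not_or] at hx
        exact h ⟨lt_of_le_of_ne h'.1 (Ne.symm hx.1), lt_of_le_of_ne h'.2 hx.2⟩
      filter_upwards [isClosed_Icc.isOpen_compl.mem_nhds hx'] with y hy
      exact (indicator_of_notMem (fun h' => hy (Ioo_subset_Icc_self h')) _).symm
  · by_cases h : x ∈ Ioo a b <;> simp [h]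

theorem pwAlg_indicator_Ico (a b : ℝ) : (Ico a b).indicator (1 : ℝ → ℝ) ∈ pwAlg := by
  refine pwAlg_congr (finite_singleton a) (pwAlg_indicator_Ioo a b) fun x hx => ?_
  have : x ∈ Ico a b ↔ x ∈ Ioo a b :=
    ⟨fun h => ⟨lt_of_le_of_ne h.1 fun h' => hx h'.symm, h.2⟩, fun h => Ioo_subset_Ico_self h⟩
  simp [indicator, this]

theorem pwAlg_aestronglyMeasurable {g : ℝ → ℝ} (hg : g ∈ pwAlg) :
    AEStronglyMeasurable g volume := by
  obtain ⟨N, hN, hc, -⟩ := hg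
  have h : AEStronglyMeasurable g (volume.restrict Nᶜ) :=
    ContinuousOn.aestronglyMeasurable (fun x hx => (hc x hx).continuousWithinAt)
      hN.isClosed.isOpen_compl.measurableSet
  have h0 : volume.restrict Nᶜ = (volume : Measure ℝ) :=
    Measure.restrict_eq_self_of_ae_mem (compl_mem_ae_iff.2 (hN.measure_zero _))
  rwa [h0] at h

theorem pwAlg_intervalIntegrable {g : ℝ → ℝ} (hg : g ∈ pwAlg) (a b : ℝ) :
    IntervalIntegrable g volume a b := by
  have hm := pwAlg_aestronglyMeasurable hg
  obtain ⟨N, hN, -, hb⟩ := hg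
  obtain ⟨M, hM⟩ := hb (max |a| |b|)
  rw [intervalIntegrable_iff]
  refine Measure.integrableOn_of_bounded (M := M) (by simp [uIoc]) hm ?_
  have h0 : ∀ᵐ x ∂(volume.restrict (uIoc a b)), x ∉ N :=
    ae_restrict_of_ae (compl_mem_ae_iff.2 (hN.measure_zero _))
  filter_upwards [h0, ae_restrict_mem measurableSet_uIoc] with x hx hxab
  refine hM x ?_ hx
  have := uIoc_subset_uIcc hxab
  rcases mem_uIcc.1 this with h | h
  · exact abs_le_max_abs_abs h.1 h.2
  · rw [max_comm]; exact abs_le_max_abs_abs h.1 h.2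

theorem intervalIntegrable_mul (f g : pwAlg) (a b : ℝ) :
    IntervalIntegrable (fun x => (f : ℝ → ℝ) x * (g : ℝ → ℝ) x) volume a b :=
  pwAlg_intervalIntegrable (f * g).2 a b

theorem continuous_primitive_of_pwAlg {g : ℝ → ℝ} (hg : g ∈ pwAlg) :
    Continuous fun x => ∫ t in (0 : ℝ)..x, g t :=
  intervalIntegral.continuous_primitive (pwAlg_intervalIntegrable hg) 0

/-- The primitive vanishing at `0`, as a linear map. -/
noncomputable def prim : pwAlg →ₗ[ℝ] pwAlg where
  toFun g := ⟨fun x => ∫ t in (0 : ℝ)..x, (g : ℝ → ℝ) t,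
    pwAlg_of_continuous (continuous_primitive_of_pwAlg g.2)⟩
  map_add' f g := by
    ext x
    exact intervalIntegral.integral_add (pwAlg_intervalIntegrable f.2 _ _)
      (pwAlg_intervalIntegrable g.2 _ _)
  map_smul' c g := by
    ext x
    exact intervalIntegral.integral_smul c _

theorem prim_apply (g : pwAlg) (x : ℝ) :
    (prim g : ℝ → ℝ) x = ∫ t in (0 : ℝ)..x, (g : ℝ → ℝ) t := rfl

theorem prim_zero_apply (g : pwAlg) : (prim g : ℝ → ℝ) 0 = 0 := by simp [prim_apply]

theorem continuous_prim (g : pwAlg) : Continuous (prim g : ℝ → ℝ) :=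
  continuous_primitive_of_pwAlg g.2

theorem hasDerivAt_prim (g : pwAlg) {x : ℝ} (hx : ContinuousAt (g : ℝ → ℝ) x) :
    HasDerivAt (prim g : ℝ → ℝ) ((g : ℝ → ℝ) x) x :=
  intervalIntegral.integral_hasDerivAt_right (pwAlg_intervalIntegrable g.2 _ _)
    ⟨univ, univ_mem, (pwAlg_aestronglyMeasurable g.2).restrict⟩ hx

/-- The `L²(a, b)` scalar product. -/
noncomputable def l2Form (a b : ℝ) : pwAlg →ₗ[ℝ] pwAlg →ₗ[ℝ] ℝ :=
  LinearMap.mk₂ ℝ (fun f g => ∫ x in a..b, (f : ℝ → ℝ) x * (g : ℝ → ℝ) x)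
    (fun f f' g => by
      rw [← intervalIntegral.integral_add (intervalIntegrable_mul f g _ _)
        (intervalIntegrable_mul f' g _ _)]
      exact intervalIntegral.integral_congr fun x _ => by simp [add_mul])
    (fun c f g => by
      rw [← intervalIntegral.integral_smul]
      exact intervalIntegral.integral_congr fun x _ => by simp [mul_assoc])
    (fun f g g' => by
      rw [← intervalIntegral.integral_add (intervalIntegrable_mul f g _ _)
        (intervalIntegrable_mul f g' _ _)]
      exact intervalIntegral.integral_congr fun x _ => by simp [mul_add])
    (fun c f g => by
      rw [← intervalIntegral.integral_smul]
      exact intervalIntegral.integral_congr fun x _ => by simp [mul_left_comm])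

theorem l2Form_apply (a b : ℝ) (f g : pwAlg) :
    l2Form a b f g = ∫ x in a..b, (f : ℝ → ℝ) x * (g : ℝ → ℝ) x := rfl

theorem isPSDForm_l2Form {a b : ℝ} (hab : a ≤ b) : IsPSDForm (l2Form a b) where
  symm f g := by simp only [l2Form_apply, mul_comm]
  nonneg f := intervalIntegral.integral_nonneg hab fun x _ => mul_self_nonneg _

theorem l2Form_one_right (a b : ℝ) (f : pwAlg) : l2Form a b f 1 = ∫ x in a..b, (f : ℝ → ℝ) x := by
  simp [l2Form_apply]

theorem l2Form_one_one : l2Form 0 1 1 1 = 1 := by simp [l2Form_one_right]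

theorem prim_one_apply (f : pwAlg) : (prim f : ℝ → ℝ) 1 = l2Form 0 1 f 1 := by
  rw [l2Form_one_right, prim_apply]

/-- Integration by parts. -/
theorem l2Form_prim_add (f g : pwAlg) :
    l2Form 0 1 (prim f) g + l2Form 0 1 f (prim g) = l2Form 0 1 f 1 * l2Form 0 1 g 1 := by
  obtain ⟨N, hN, hNc, -⟩ := f.2
  obtain ⟨N', hN', hNc', -⟩ := g.2
  have h := integral_eq_of_hasDerivAt_off_countable_of_le
    (fun x => (prim f : ℝ → ℝ) x * (prim g : ℝ → ℝ) x)
    (fun x => (f : ℝ → ℝ) x * (prim g : ℝ → ℝ) x + (prim f : ℝ → ℝ) x * (g : ℝ → ℝ) x)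
    zero_le_one (hN.union hN').countable
    ((continuous_prim f).mul (continuous_prim g)).continuousOn
    (fun x hx => (hasDerivAt_prim f (hNc x fun h => hx.2 (Or.inl h))).mul
      (hasDerivAt_prim g (hNc' x fun h => hx.2 (Or.inr h))))
    ((intervalIntegrable_mul f (prim g) _ _).add
      (intervalIntegrable_mul (prim f) g _ _))
  rw [intervalIntegral.integral_add (intervalIntegrable_mul f (prim g) _ _)
      (intervalIntegrable_mul (prim f) g _ _)] at h
  simp only [prim_zero_apply, prim_one_apply, mul_zero, sub_zero] at h
  rw [← h, add_comm]
  rfl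

theorem l2Form_congr {f f' g g' : pwAlg} {N : Set ℝ} (hN : N.Finite)
    (hf : ∀ x ∈ Ioo (0 : ℝ) 1, x ∉ N → (f : ℝ → ℝ) x = (f' : ℝ → ℝ) x)
    (hg : ∀ x ∈ Ioo (0 : ℝ) 1, x ∉ N → (g : ℝ → ℝ) x = (g' : ℝ → ℝ) x) :
    l2Form 0 1 f g = l2Form 0 1 f' g' := by
  refine intervalIntegral.integral_congr_ae ?_
  have h0 : ∀ᵐ x : ℝ, x ∉ N ∪ {1} :=
    compl_mem_ae_iff.2 ((hN.union (finite_singleton 1)).measure_zero _)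
  filter_upwards [h0] with x hx hx1
  rw [uIoc_of_le zero_le_one] at hx1
  have hx' : x ∈ Ioo (0 : ℝ) 1 := ⟨hx1.1, lt_of_le_of_ne hx1.2 fun h => hx (Or.inr h)⟩
  rw [hf x hx' fun h => hx (Or.inl h), hg x hx' fun h => hx (Or.inl h)]

/-- The functions which are constant on the cells `[i / n, (i + 1) / n)`, `i < n`, and off
`[0, 1)`. -/
def pwConst (n : ℕ) : Submodule ℝ pwAlg :=
  -- The constant 1 is added by hand: the cell indicators sum only to the indicator of [0, 1), while
  -- the ladder needs 1 as a function on ℝ.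
  Submodule.span ℝ (insert 1 (range fun i : Fin n =>
    (⟨_, pwAlg_indicator_Ico ((i : ℕ) * (1 / n : ℝ)) (((i : ℕ) + 1) * (1 / n : ℝ))⟩ : pwAlg)))

instance (n : ℕ) : FiniteDimensional ℝ (pwConst n) :=
  FiniteDimensional.span_of_finite ℝ ((finite_range _).insert _)

theorem one_mem_pwConst (n : ℕ) : 1 ∈ pwConst n := Submodule.subset_span (mem_insert _ _)

theorem eq_of_mem_cells {n i j : ℕ} {x : ℝ} (hn : 0 < n)
    (hi : x ∈ Ico ((i : ℝ) * (1 / n : ℝ)) (((i : ℝ) + 1) * (1 / n : ℝ)))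
    (hj : x ∈ Ico ((j : ℝ) * (1 / n : ℝ)) (((j : ℝ) + 1) * (1 / n : ℝ))) : i = j := by
  have h0 : (0 : ℝ) < 1 / n := by positivity
  have h1 := lt_of_mul_lt_mul_right (hi.1.trans_lt hj.2) h0.le
  have h2 := lt_of_mul_lt_mul_right (hj.1.trans_lt hi.2) h0.le
  have h3 : i < j + 1 := by exact_mod_cast h1
  have h4 : j < i + 1 := by exact_mod_cast h2
  omega

theorem sq_integral_le (g : pwAlg) {a x b : ℝ} (hax : a ≤ x) (hxb : x ≤ b) :
    (∫ t in a..x, (g : ℝ → ℝ) t) ^ 2 ≤ (b - a) * l2Form a b g g := by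
  have h1 := (isPSDForm_l2Form hax).cauchy_schwarz g 1
  have h2 : l2Form a x 1 1 = x - a := by simp [l2Form_one_right]
  rw [h2, l2Form_one_right] at h1
  have h3 : l2Form a x g g + l2Form x b g g = l2Form a b g g :=
    intervalIntegral.integral_add_adjacent_intervals (intervalIntegrable_mul g g _ _)
      (intervalIntegrable_mul g g _ _)
  have h4 := (isPSDForm_l2Form hxb).nonneg g
  have h5 := (isPSDForm_l2Form hax).nonneg g
  calc _ ≤ _ := h1
    _ ≤ l2Form a b g g * (b - a) := by
      apply mul_le_mul (by linarith) (by linarith) (by linarith) (by linarith)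
    _ = _ := mul_comm _ _

/-- Interpolate at the left end of each cell. The error there is the integral of g from that end,
whose square is at most h times the integral of g² over the cell; integrating over a length h gives
the second factor h. -/
theorem exists_pwConst_approx {n : ℕ} (hn : 0 < n) (c : ℝ) (g : pwAlg) :
    ∃ s ∈ pwConst n, l2Form 0 1 (c • 1 + prim g - s) (c • 1 + prim g - s) ≤
      (1 / n : ℝ) ^ 2 * l2Form 0 1 g g := by
  set h : ℝ := 1 / n with hh
  have h0 : 0 < h := by positivity
  set u : pwAlg := c • 1 + prim g with hu
  let χ : Fin n → pwAlg := fun i =>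
    ⟨_, pwAlg_indicator_Ico ((i : ℕ) * (1 / n : ℝ)) (((i : ℕ) + 1) * (1 / n : ℝ))⟩
  set s : pwAlg := ∑ i : Fin n, (u : ℝ → ℝ) (i * h) • χ i with hs
  refine ⟨s, Submodule.sum_mem _ fun i _ => Submodule.smul_mem _ _
    (Submodule.subset_span (mem_insert_of_mem _ (mem_range_self i))), ?_⟩
  have hsx : ∀ i < n, ∀ x ∈ Ico ((i : ℝ) * h) (((i : ℝ) + 1) * h),
      (s : ℝ → ℝ) x = (u : ℝ → ℝ) (i * h) := fun i hi x hx => by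
    have h1 : (s : ℝ → ℝ) x = ∑ j : Fin n, (u : ℝ → ℝ) (j * h) * (χ j : ℝ → ℝ) x := by
      simp [hs]
    rw [h1, Finset.sum_eq_single (⟨i, hi⟩ : Fin n)]
    · simp only [χ]
      rw [indicator_of_mem hx]
      simp
    · intro j _ hj
      simp only [χ]
      rw [indicator_of_notMem, mul_zero]
      exact fun hxj => hj (Fin.ext (eq_of_mem_cells hn hxj hx))
    · simp
  have hux : ∀ a x, (u : ℝ → ℝ) x - (u : ℝ → ℝ) a = ∫ t in a..x, (g : ℝ → ℝ) t := fun a x => by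
    have := intervalIntegral.integral_add_adjacent_intervals
      (pwAlg_intervalIntegrable g.2 0 a) (pwAlg_intervalIntegrable g.2 a x)
    simp only [hu, Subalgebra.coe_add, Pi.add_apply, prim_apply, ← this]
    simp
  have hcell : ∀ i < n, l2Form (i * h) ((i + 1 : ℕ) * h) (u - s) (u - s) ≤
      h ^ 2 * l2Form (i * h) ((i + 1 : ℕ) * h) g g := fun i hi => by
    have hle : (i : ℝ) * h ≤ ((i + 1 : ℕ) : ℝ) * h := by
      push_cast; nlinarith
    have hlen : ((i + 1 : ℕ) : ℝ) * h - i * h = h := by push_cast; ring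
    have hb : ∀ x ∈ Ioo ((i : ℝ) * h) (((i + 1 : ℕ) : ℝ) * h),
        ((u - s : pwAlg) : ℝ → ℝ) x * ((u - s : pwAlg) : ℝ → ℝ) x ≤
          h * l2Form (i * h) ((i + 1 : ℕ) * h) g g := fun x hx => by
      have h1 : ((u - s : pwAlg) : ℝ → ℝ) x = ∫ t in (i * h)..x, (g : ℝ → ℝ) t := by
        rw [← hux, ← hsx i hi x ⟨hx.1.le, by have := hx.2; push_cast at this; exact this⟩]
        rfl
      rw [h1, ← sq, ← congrArg (· * _) hlen]
      exact sq_integral_le g hx.1.le hx.2.le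
    calc _ ≤ ∫ _ in (i * h)..((i + 1 : ℕ) * h), h * l2Form (i * h) ((i + 1 : ℕ) * h) g g :=
          intervalIntegral.integral_mono_on_of_le_Ioo hle
            (intervalIntegrable_mul (u - s) (u - s) _ _) (by simp) hb
      _ = _ := by rw [intervalIntegral.integral_const, hlen, smul_eq_mul]; ring
  have hsum : ∀ f : pwAlg, l2Form 0 1 f f =
      ∑ i ∈ Finset.range n, l2Form (i * h) ((i + 1 : ℕ) * h) f f := fun f => by
    have h1 := intervalIntegral.sum_integral_adjacent_intervals (μ := volume)
      (f := fun x => (f : ℝ → ℝ) x * (f : ℝ → ℝ) x) (a := fun i : ℕ => (i : ℝ) * h) (n := n)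
      fun i _ => intervalIntegrable_mul f f _ _
    have hn1 : (n : ℝ) * h = 1 := by rw [hh]; field_simp
    simp only [Nat.cast_zero, zero_mul, hn1] at h1
    exact h1.symm
  rw [hsum, hsum, Finset.mul_sum]
  exact Finset.sum_le_sum fun i hi => hcell i (Finset.mem_range.1 hi)

/-! ### The concrete ladder: piecewise polynomials, smoothness, boundary conditions -/

section Ladder

theorem exists_polynomial_antiderivative (q : Polynomial ℝ) {p : ℕ} (hq : q.natDegree ≤ p) :
    ∃ Q : Polynomial ℝ, Q.natDegree ≤ p + 1 ∧ Polynomial.derivative Q = q := by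
  refine ⟨∑ k ∈ Finset.range (p + 1), Polynomial.monomial (k + 1) (q.coeff k / (k + 1)),
    Polynomial.natDegree_sum_le_of_forall_le _ _ fun k hk =>
      (Polynomial.natDegree_monomial_le _).trans (by simpa using Finset.mem_range.1 hk), ?_⟩
  conv_rhs => rw [q.as_sum_range' (p + 1) (by omega)]
  rw [Polynomial.derivative_sum]
  refine Finset.sum_congr rfl fun k _ => ?_
  rw [Polynomial.derivative_monomial]
  congr 1
  push_cast
  field_simp

/-- On every open cell of the grid with `n` cells, `f` is a polynomial of degree at most `p`. -/
def IsPiecewisePoly (n p : ℕ) (f : ℝ → ℝ) : Prop :=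
  ∀ i : ℕ, i < n → ∃ q : Polynomial ℝ, q.natDegree ≤ p ∧
    ∀ x ∈ Ioo ((i : ℝ) * (1 / n : ℝ)) (((i : ℝ) + 1) * (1 / n : ℝ)), f x = q.eval x

variable {n p : ℕ}

theorem IsPiecewisePoly.add {f g : ℝ → ℝ} (hf : IsPiecewisePoly n p f)
    (hg : IsPiecewisePoly n p g) : IsPiecewisePoly n p (f + g) := fun i hi => by
  obtain ⟨q, hq, hq'⟩ := hf i hi
  obtain ⟨r, hr, hr'⟩ := hg i hi
  exact ⟨q + r, Polynomial.natDegree_add_le_of_degree_le hq hr,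
    fun x hx => by simp [hq' x hx, hr' x hx]⟩

theorem IsPiecewisePoly.const_smul {f : ℝ → ℝ} (hf : IsPiecewisePoly n p f) (c : ℝ) :
    IsPiecewisePoly n p (c • f) := fun i hi => by
  obtain ⟨q, hq, hq'⟩ := hf i hi
  exact ⟨c • q, (Polynomial.natDegree_smul_le c q).trans hq, fun x hx => by simp [hq' x hx]⟩

theorem isPiecewisePoly_const (c : ℝ) : IsPiecewisePoly n p fun _ => c := fun _ _ =>
  ⟨Polynomial.C c, by simp, by simp⟩

theorem IsPiecewisePoly.prim {f : pwAlg} (hf : IsPiecewisePoly n p (f : ℝ → ℝ)) :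
    IsPiecewisePoly n (p + 1) (SplineMG.prim f : ℝ → ℝ) := fun i hi => by
  obtain ⟨q, hq, hq'⟩ := hf i hi
  obtain ⟨Q, hQ, hQd⟩ := exists_polynomial_antiderivative q hq
  set s := Ioo ((i : ℝ) * (1 / n : ℝ)) (((i : ℝ) + 1) * (1 / n : ℝ)) with hs
  have hd : ∀ x ∈ s, HasDerivAt (fun x => (SplineMG.prim f : ℝ → ℝ) x - Q.eval x) 0 x := by
    intro x hx
    have hfc : ContinuousAt (f : ℝ → ℝ) x := by
      refine q.continuous.continuousAt.congr ?_
      filter_upwards [isOpen_Ioo.mem_nhds hx] with y hy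
      exact (hq' y hy).symm
    have := (hasDerivAt_prim f hfc).sub (Q.hasDerivAt x)
    rwa [hq' x hx, hQd, sub_self] at this
  obtain ⟨a, ha⟩ := IsOpen.exists_is_const_of_deriv_eq_zero (s := s) isOpen_Ioo
    isPreconnected_Ioo (fun x hx => (hd x hx).differentiableAt.differentiableWithinAt)
    fun x hx => (hd x hx).deriv
  refine ⟨Q + Polynomial.C a, Polynomial.natDegree_add_le_of_degree_le hQ (by simp),
    fun x hx => ?_⟩
  have := ha x hx
  simp only [Polynomial.eval_add, Polynomial.eval_C]
  linarith

theorem isPiecewisePoly_of_mem_pwConst {f : pwAlg} (hn : 0 < n) (hf : f ∈ pwConst n) :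
    IsPiecewisePoly n 0 (f : ℝ → ℝ) := by
  induction hf using Submodule.span_induction with
  | mem x h =>
    rcases h with rfl | ⟨i, rfl⟩
    · exact isPiecewisePoly_const 1
    · intro j hj
      by_cases hij : (i : ℕ) = j
      · refine ⟨1, by simp, fun x hx => ?_⟩
        rw [← hij] at hx
        simp only [indicator_of_mem (Ioo_subset_Ico_self hx), Polynomial.eval_one, Pi.one_apply]
      · refine ⟨0, by simp, fun x hx => ?_⟩
        rw [Polynomial.eval_zero]
        exact indicator_of_notMem
          (fun h => hij (eq_of_mem_cells hn h (Ioo_subset_Ico_self hx))) _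
  | zero => exact isPiecewisePoly_const 0
  | add f g _ _ hf hg => exact hf.add hg
  | smul c f _ hf => exact hf.const_smul c

/-- The pair of spline spaces of degree `p` without boundary conditions on even derivatives,
respectively with homogeneous boundary conditions on even derivatives. -/
noncomputable def splineLadder (n p : ℕ) : Submodule ℝ pwAlg × Submodule ℝ pwAlg :=
  ladder (l2Form 0 1) prim 1 (pwConst n) p

theorem mem_splineLadder_succ_fst {f : pwAlg} :
    f ∈ (splineLadder n (p + 1)).1 ↔ ∃ c : ℝ, ∃ g ∈ (splineLadder n p).2, c • 1 + prim g = f := by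
  simp only [splineLadder, ladder, Submodule.mem_sup, Submodule.mem_span_singleton,
    Submodule.mem_map]
  constructor
  · rintro ⟨_, ⟨c, rfl⟩, _, ⟨g, hg, rfl⟩, rfl⟩
    exact ⟨c, g, hg, rfl⟩
  · rintro ⟨c, g, hg, rfl⟩
    exact ⟨_, ⟨c, rfl⟩, _, ⟨g, hg, rfl⟩, rfl⟩

theorem mem_splineLadder_succ_snd {f : pwAlg} :
    f ∈ (splineLadder n (p + 1)).2 ↔
      ∃ g ∈ (splineLadder n p).1, l2Form 0 1 1 g = 0 ∧ prim g = f := by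
  simp [splineLadder, ladder, Submodule.mem_map, and_assoc]

theorem isPiecewisePoly_splineLadder (hn : 0 < n) (p : ℕ) :
    (∀ f ∈ (splineLadder n p).1, IsPiecewisePoly n p (f : ℝ → ℝ)) ∧
    ∀ f ∈ (splineLadder n p).2, IsPiecewisePoly n p (f : ℝ → ℝ) := by
  induction p with
  | zero => exact ⟨fun f hf => isPiecewisePoly_of_mem_pwConst hn hf,
      fun f hf => isPiecewisePoly_of_mem_pwConst hn hf⟩
  | succ p ih =>
    refine ⟨fun f hf => ?_, fun f hf => ?_⟩
    · obtain ⟨c, g, hg, rfl⟩ := mem_splineLadder_succ_fst.1 hf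
      exact ((isPiecewisePoly_const 1).const_smul c).add (ih.2 g hg).prim
    · obtain ⟨g, hg, -, rfl⟩ := mem_splineLadder_succ_snd.1 hf
      exact (ih.1 g hg).prim

theorem deriv_smul_one_add_prim (c : ℝ) {g : pwAlg} (hg : Continuous (g : ℝ → ℝ)) (x : ℝ) :
    HasDerivAt ((c • 1 + prim g : pwAlg) : ℝ → ℝ) ((g : ℝ → ℝ) x) x := by
  have := (hasDerivAt_const x c).add (hasDerivAt_prim g hg.continuousAt)
  rw [zero_add] at this
  refine this.congr_of_eventuallyEq (Eventually.of_forall fun y => ?_)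
  simp

theorem contDiff_smul_one_add_prim (c : ℝ) {g : pwAlg} {q : ℕ}
    (hg : ContDiff ℝ q (g : ℝ → ℝ)) :
    ContDiff ℝ (q + 1 : ℕ) ((c • 1 + prim g : pwAlg) : ℝ → ℝ) := by
  have hd := deriv_smul_one_add_prim c hg.continuous
  push_cast
  rw [contDiff_succ_iff_deriv]
  refine ⟨fun x => (hd x).differentiableAt, by simp, ?_⟩
  exact (funext fun x => (hd x).deriv : deriv ((c • 1 + prim g : pwAlg) : ℝ → ℝ) = g) ▸ hg

/-- Smoothness and boundary conditions of the ladder of spline spaces. -/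
theorem splineLadder_smooth (q : ℕ) :
    (∀ f ∈ (splineLadder n (q + 1)).1, ContDiff ℝ q (f : ℝ → ℝ) ∧ ∀ l, 2 * l + 1 ≤ q →
      iteratedDeriv (2 * l + 1) (f : ℝ → ℝ) 0 = 0 ∧
      iteratedDeriv (2 * l + 1) (f : ℝ → ℝ) 1 = 0) ∧
    (∀ f ∈ (splineLadder n (q + 1)).2, ContDiff ℝ q (f : ℝ → ℝ) ∧ ∀ l, 2 * l ≤ q →
      iteratedDeriv (2 * l) (f : ℝ → ℝ) 0 = 0 ∧ iteratedDeriv (2 * l) (f : ℝ → ℝ) 1 = 0) := by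
  have hbd : ∀ g : pwAlg, l2Form 0 1 1 g = 0 →
      (prim g : ℝ → ℝ) 0 = 0 ∧ (prim g : ℝ → ℝ) 1 = 0 := fun g hg =>
    ⟨prim_zero_apply g, by rw [prim_one_apply, (isPSDForm_l2Form zero_le_one).symm, hg]⟩
  have hcont : ∀ (c : ℝ) (g : pwAlg), Continuous ((c • 1 + prim g : pwAlg) : ℝ → ℝ) := fun c g =>
    (continuous_const (y := c * 1)).add (continuous_prim g)
  have hzero : ∀ g : pwAlg, (0 : ℝ) • (1 : pwAlg) + prim g = prim g := fun g => by simp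
  induction q with
  | zero =>
    refine ⟨fun f hf => ?_, fun f hf => ?_⟩
    · obtain ⟨c, g, hg, rfl⟩ := mem_splineLadder_succ_fst.1 hf
      refine ⟨contDiff_zero.2 (hcont c g), fun l hl => by omega⟩
    · obtain ⟨g, hg, hg0, rfl⟩ := mem_splineLadder_succ_snd.1 hf
      refine ⟨contDiff_zero.2 (continuous_prim g), fun l hl => ?_⟩
      obtain rfl : l = 0 := by omega
      simpa using hbd g hg0
  | succ q ih =>
    refine ⟨fun f hf => ?_, fun f hf => ?_⟩
    · obtain ⟨c, g, hg, rfl⟩ := mem_splineLadder_succ_fst.1 hf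
      obtain ⟨hgc, hgb⟩ := ih.2 g hg
      refine ⟨contDiff_smul_one_add_prim c hgc, fun l hl => ?_⟩
      rw [iteratedDeriv_succ', show deriv ((c • 1 + prim g : pwAlg) : ℝ → ℝ) = g from
        funext fun x => (deriv_smul_one_add_prim c hgc.continuous x).deriv]
      exact hgb l (by omega)
    · obtain ⟨g, hg, hg0, rfl⟩ := mem_splineLadder_succ_snd.1 hf
      obtain ⟨hgc, hgb⟩ := ih.1 g hg
      rw [← hzero g]
      refine ⟨contDiff_smul_one_add_prim 0 hgc, fun l hl => ?_⟩
      -- Order zero is not inherited from g: the primitive vanishes at 1 because g has mean zero.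
      -- Higher even orders are odd orders of g.
      rcases l with - | l
      · simpa using hbd g hg0
      · rw [show 2 * (l + 1) = 2 * l + 1 + 1 by ring, iteratedDeriv_succ',
          show deriv (((0 : ℝ) • 1 + prim g : pwAlg) : ℝ → ℝ) = g from
            funext fun x => (deriv_smul_one_add_prim 0 hgc.continuous x).deriv]
        exact hgb l (by omega)

theorem cell_subset {n i : ℕ} (hi : i < n) :
    Ioo ((i : ℝ) * (1 / n : ℝ)) (((i : ℝ) + 1) * (1 / n : ℝ)) ⊆ Ioo 0 1 := by
  have hn : (0 : ℝ) < n := by exact_mod_cast (Nat.zero_le i).trans_lt hi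
  refine fun x hx => ⟨lt_of_le_of_lt (by positivity) hx.1, hx.2.trans_le ?_⟩
  rw [mul_one_div, div_le_one hn]
  exact_mod_cast hi

/-- Supplies the test functions. Only this inclusion of the ladder space in S̃ is needed, not
equality. -/
theorem indicator_mem_splineTilde {n₀ ℓ q : ℕ} (hn : 0 < gridCount n₀ ℓ) {f : pwAlg}
    (hf : f ∈ (splineLadder (gridCount n₀ ℓ) (q + 1)).1) :
    (Ioo (0 : ℝ) 1).indicator (f : ℝ → ℝ) ∈ splineTilde (q + 1) n₀ ℓ := by
  obtain ⟨hc, hb⟩ := (splineLadder_smooth q).1 f hf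
  have hpp := (isPiecewisePoly_splineLadder hn (q + 1)).1 f hf
  have hS : (Ioo (0 : ℝ) 1).indicator (f : ℝ → ℝ) ∈ splineSpace (q + 1) n₀ ℓ := by
    refine ⟨fun x hx => indicator_of_notMem hx _, ?_, fun i hi => ?_⟩
    · exact hc.contDiffOn.congr fun x hx => indicator_of_mem hx _
    · obtain ⟨r, hr, hr'⟩ := hpp i hi
      refine ⟨r, hr, fun x hx => ?_⟩
      rw [← hr' x hx]
      exact indicator_of_mem (cell_subset hi hx) _
  refine ⟨hS, fun l hl => ?_⟩
  have hcont : Continuous (iteratedDeriv (2 * l + 1) (f : ℝ → ℝ)) :=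
    hc.continuous_iteratedDeriv (2 * l + 1) (by exact_mod_cast Nat.lt_succ_iff.1 hl)
  have heq : ∀ x ∈ Ioo (0 : ℝ) 1, iteratedDeriv (2 * l + 1) (f : ℝ → ℝ) x =
      iteratedDeriv (2 * l + 1) ((Ioo (0 : ℝ) 1).indicator (f : ℝ → ℝ)) x := fun x hx => by
    refine Filter.EventuallyEq.iteratedDeriv_eq _ ?_
    filter_upwards [isOpen_Ioo.mem_nhds hx] with y hy
    exact (indicator_of_mem hy _).symm
  obtain ⟨hb0, hb1⟩ := hb l (by omega)
  constructor
  · have := (hcont.tendsto 0).mono_left (nhdsWithin_le_nhds (s := Ioi 0))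
    rw [hb0] at this
    refine this.congr' ?_
    filter_upwards [Ioo_mem_nhdsGT (zero_lt_one' ℝ)] with x hx using heq x hx
  · have := (hcont.tendsto 1).mono_left (nhdsWithin_le_nhds (s := Iio 1))
    rw [hb1] at this
    refine this.congr' ?_
    filter_upwards [Ioo_mem_nhdsLT (zero_lt_one' ℝ)] with x hx using heq x hx

end Ladder

/-! ### Grid points and piecewise polynomials given by their pieces -/

section Grid

/-- The points of the grid with `n` cells. -/
def gridSet (n : ℕ) : Set ℝ := (fun j : ℕ => (j : ℝ) * (1 / n : ℝ)) '' Iic n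

theorem finite_gridSet (n : ℕ) : (gridSet n).Finite := (finite_Iic n).image _

theorem zero_mem_gridSet (n : ℕ) : (0 : ℝ) ∈ gridSet n := ⟨0, by simp, by simp⟩

theorem one_mem_gridSet {n : ℕ} (hn : 0 < n) : (1 : ℝ) ∈ gridSet n :=
  ⟨n, by simp, by field_simp⟩

theorem exists_mem_cell {n : ℕ} (hn : 0 < n) {x : ℝ} (hx : x ∈ Ioo (0 : ℝ) 1)
    (hxg : x ∉ gridSet n) :
    ∃ i < n, x ∈ Ioo ((i : ℝ) * (1 / n : ℝ)) (((i : ℝ) + 1) * (1 / n : ℝ)) := by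
  have hn' : (0 : ℝ) < n := by exact_mod_cast hn
  have h0 : 0 ≤ x * n := by have := hx.1; positivity
  have h1 : (⌊x * n⌋₊ : ℝ) ≤ x * n := Nat.floor_le h0
  have h2 : x * n < ⌊x * n⌋₊ + 1 := Nat.lt_floor_add_one _
  have h3 : ⌊x * n⌋₊ < n := by
    rw [Nat.floor_lt h0]
    nlinarith [hx.2]
  refine ⟨_, h3, lt_of_le_of_ne ?_ fun h => hxg ⟨_, mem_Iic.2 h3.le, h⟩, ?_⟩
  · rw [mul_one_div, div_le_iff₀ hn']; exact h1
  · rw [mul_one_div, lt_div_iff₀ hn']; exact h2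

/-- The piecewise polynomial with given pieces. -/
noncomputable def ofPieces (n : ℕ) (q : Fin n → Polynomial ℝ) : ℝ → ℝ := fun x =>
  ∑ i : Fin n, (Ioo ((i : ℕ) * (1 / n : ℝ)) (((i : ℕ) + 1) * (1 / n : ℝ))).indicator (1 : ℝ → ℝ) x *
    (q i).eval x

theorem ofPieces_mem_pwAlg (n : ℕ) (q : Fin n → Polynomial ℝ) : ofPieces n q ∈ pwAlg := by
  have h : ofPieces n q = ∑ i : Fin n, (Ioo ((i : ℕ) * (1 / n : ℝ))
      (((i : ℕ) + 1) * (1 / n : ℝ))).indicator (1 : ℝ → ℝ) * fun x => (q i).eval x := by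
    ext x
    simp [ofPieces]
  rw [h]
  exact sum_mem fun i _ => mul_mem (pwAlg_indicator_Ioo _ _) (pwAlg_of_continuous (q i).continuous)

theorem ofPieces_of_mem_cell {n : ℕ} (hn : 0 < n) (q : Fin n → Polynomial ℝ) (i : Fin n) {x : ℝ}
    (hx : x ∈ Ioo ((i : ℕ) * (1 / n : ℝ)) (((i : ℕ) + 1) * (1 / n : ℝ))) :
    ofPieces n q x = (q i).eval x := by
  rw [ofPieces, Finset.sum_eq_single i]
  · rw [indicator_of_mem hx, Pi.one_apply, one_mul]
  · intro j _ hj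
    rw [indicator_of_notMem, zero_mul]
    exact fun h => hj (Fin.ext (eq_of_mem_cells hn (Ioo_subset_Ico_self h) (Ioo_subset_Ico_self hx)))
  · simp

theorem ofPieces_of_notMem {n : ℕ} (q : Fin n → Polynomial ℝ) {x : ℝ} (hx : x ∉ Ioo (0 : ℝ) 1) :
    ofPieces n q x = 0 :=
  Finset.sum_eq_zero fun i _ => by
    rw [indicator_of_notMem fun h => hx (cell_subset i.2 h), zero_mul]

theorem eq_ofPieces {n : ℕ} (hn : 0 < n) {u : ℝ → ℝ} {q : Fin n → Polynomial ℝ}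
    (h0 : ∀ x ∉ Ioo (0 : ℝ) 1, x ∉ gridSet n → u x = 0)
    (hq : ∀ i : Fin n, ∀ x ∈ Ioo ((i : ℕ) * (1 / n : ℝ)) (((i : ℕ) + 1) * (1 / n : ℝ)),
      u x = (q i).eval x) : ∀ x ∉ gridSet n, u x = ofPieces n q x := fun x hx => by
  by_cases h : x ∈ Ioo (0 : ℝ) 1
  · obtain ⟨i, hi, hxi⟩ := exists_mem_cell hn h hx
    rw [hq ⟨i, hi⟩ x hxi, ofPieces_of_mem_cell hn q ⟨i, hi⟩ hxi]
  · rw [h0 x h hx, ofPieces_of_notMem q h]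

end Grid

/-! ### Univariate splines and the error operator of the H¹ projector -/

section Spline

variable {p n₀ ℓ : ℕ}

theorem exists_pieces {u : ℝ → ℝ} (hu : u ∈ splineSpace p n₀ ℓ) :
    ∃ q : Fin (gridCount n₀ ℓ) → Polynomial ℝ, (∀ i, (q i).natDegree ≤ p) ∧
      ∀ i : Fin (gridCount n₀ ℓ), ∀ x ∈ Ioo ((i : ℕ) * (1 / gridCount n₀ ℓ : ℝ))
        (((i : ℕ) + 1) * (1 / gridCount n₀ ℓ : ℝ)), u x = (q i).eval x := by
  have h := hu.2.2
  choose q hq hq' using fun i : Fin (gridCount n₀ ℓ) => h i i.2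
  exact ⟨q, hq, hq'⟩

/-- The grid contains 0 and 1, so possible jumps of the extension by zero are excluded along with
interior kinks. -/
theorem splineSpace_hasDerivAt (hn : 0 < gridCount n₀ ℓ) {u : ℝ → ℝ} (hu : u ∈ splineSpace p n₀ ℓ)
    {q : Fin (gridCount n₀ ℓ) → Polynomial ℝ}
    (hq : ∀ i : Fin (gridCount n₀ ℓ), ∀ x ∈ Ioo ((i : ℕ) * (1 / gridCount n₀ ℓ : ℝ))
        (((i : ℕ) + 1) * (1 / gridCount n₀ ℓ : ℝ)), u x = (q i).eval x)
    {x : ℝ} (hx : x ∉ gridSet (gridCount n₀ ℓ)) :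
    HasDerivAt u (ofPieces _ (fun i => Polynomial.derivative (q i)) x) x := by
  by_cases h : x ∈ Ioo (0 : ℝ) 1
  · obtain ⟨i, hi, hxi⟩ := exists_mem_cell hn h hx
    rw [ofPieces_of_mem_cell hn _ ⟨i, hi⟩ hxi]
    refine ((q ⟨i, hi⟩).hasDerivAt x).congr_of_eventuallyEq ?_
    filter_upwards [isOpen_Ioo.mem_nhds hxi] with y hy using hq ⟨i, hi⟩ y hy
  · rw [ofPieces_of_notMem _ h]
    have hx' : x ∈ (Icc (0 : ℝ) 1)ᶜ := fun h' => h
      ⟨lt_of_le_of_ne h'.1 fun h0 => hx (h0 ▸ zero_mem_gridSet _),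
        lt_of_le_of_ne h'.2 fun h1 => hx (h1 ▸ one_mem_gridSet hn)⟩
    refine (hasDerivAt_const x (0 : ℝ)).congr_of_eventuallyEq ?_
    filter_upwards [isClosed_Icc.isOpen_compl.mem_nhds hx'] with y hy
    exact hu.1 y fun h => hy (Ioo_subset_Icc_self h)

theorem splineSpace_differentiableAt (hn : 0 < gridCount n₀ ℓ) {u : ℝ → ℝ} (hu : u ∈ splineSpace p n₀ ℓ) {x : ℝ}
    (hx : x ∉ gridSet (gridCount n₀ ℓ)) : DifferentiableAt ℝ u x := by
  obtain ⟨q, -, hq⟩ := exists_pieces hu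
  exact (splineSpace_hasDerivAt hn hu hq hx).differentiableAt

theorem splineSpace_le_pwAlg (hn : 0 < gridCount n₀ ℓ) {u : ℝ → ℝ} (hu : u ∈ splineSpace p n₀ ℓ) : u ∈ pwAlg := by
  obtain ⟨q, -, hq⟩ := exists_pieces hu
  exact pwAlg_congr (finite_gridSet _) (ofPieces_mem_pwAlg _ q)
    (eq_ofPieces hn (fun x hx _ => hu.1 x hx) hq)

theorem indicator_deriv_mem_pwAlg (hn : 0 < gridCount n₀ ℓ) {u : ℝ → ℝ} (hu : u ∈ splineSpace p n₀ ℓ) :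
    (gridSet (gridCount n₀ ℓ))ᶜ.indicator (deriv u) ∈ pwAlg := by
  obtain ⟨q, -, hq⟩ := exists_pieces hu
  refine pwAlg_congr (finite_gridSet (gridCount n₀ ℓ))
    (ofPieces_mem_pwAlg _ fun i => Polynomial.derivative (q i)) fun x hx => ?_
  rw [indicator_of_mem hx, (splineSpace_hasDerivAt hn hu hq hx).deriv]

theorem splineSpace_continuousOn {u : ℝ → ℝ} (hu : u ∈ splineSpace p n₀ ℓ) :
    ContinuousOn u (Ioo 0 1) := hu.2.1.continuousOn

theorem splineSpace_eq_of_ae {u v : ℝ → ℝ} (hu : u ∈ splineSpace p n₀ ℓ)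
    (hv : v ∈ splineSpace p n₀ ℓ) (h : ∀ᵐ x ∂volume.restrict (Ioo (0 : ℝ) 1), u x = v x) :
    u = v := by
  have h1 := Measure.eqOn_open_of_ae_eq h isOpen_Ioo (splineSpace_continuousOn hu)
    (splineSpace_continuousOn hv)
  ext x
  by_cases hx : x ∈ Ioo (0 : ℝ) 1
  · exact h1 hx
  · rw [hu.1 x hx, hv.1 x hx]

/-- The inclusion of the spline space. -/
def splineIncl (hn : 0 < gridCount n₀ ℓ) : splineSpace p n₀ ℓ →ₗ[ℝ] pwAlg where
  toFun u := ⟨u, splineSpace_le_pwAlg hn u.2⟩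
  map_add' _ _ := rfl
  map_smul' _ _ := rfl

/-- The derivative of splines, with the value zero at the grid points. -/
noncomputable def splineDeriv (hn : 0 < gridCount n₀ ℓ) : splineSpace p n₀ ℓ →ₗ[ℝ] pwAlg where
  -- Erasing the grid values makes the map linear: `deriv` need not be additive where splines are
  -- not differentiable.
  toFun u := ⟨_, indicator_deriv_mem_pwAlg hn u.2⟩
  map_add' u v := by
    ext x
    by_cases hx : x ∈ gridSet (gridCount n₀ ℓ)
    · simp [hx]
    · simp only [Subalgebra.coe_add, Pi.add_apply, indicator_of_mem (mem_compl hx)]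
      exact deriv_add (splineSpace_differentiableAt hn u.2 hx)
        (splineSpace_differentiableAt hn v.2 hx)
  map_smul' c u := by
    ext x
    by_cases hx : x ∈ gridSet (gridCount n₀ ℓ)
    · simp [hx]
    · simp only [Subalgebra.coe_smul, Pi.smul_apply, indicator_of_mem (mem_compl hx)]
      exact deriv_const_smul c (splineSpace_differentiableAt hn u.2 hx)

theorem splineIncl_apply (hn : 0 < gridCount n₀ ℓ) (u : splineSpace p n₀ ℓ) :
    (splineIncl hn u : ℝ → ℝ) = u := rfl

theorem splineDeriv_apply (hn : 0 < gridCount n₀ ℓ) (u : splineSpace p n₀ ℓ) {x : ℝ}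
    (hx : x ∉ gridSet (gridCount n₀ ℓ)) :
    (splineDeriv hn u : ℝ → ℝ) x = deriv (u : ℝ → ℝ) x := indicator_of_mem (mem_compl hx) _

/-- Off the grid a spline is determined by finitely many polynomials of bounded degree, and
continuity on (0,1) recovers its values at the interior grid points. -/
theorem finiteDimensional_splineSpace (hn : 0 < gridCount n₀ ℓ) : FiniteDimensional ℝ (splineSpace p n₀ ℓ) := by
  set n := gridCount n₀ ℓ with hnn
  let Φ : (Fin n → Polynomial.degreeLT ℝ (p + 1)) →ₗ[ℝ] ℝ → ℝ :=
    { toFun := fun q => (gridSet n)ᶜ.indicator (ofPieces n fun i => (q i : Polynomial ℝ))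
      map_add' := fun q r => by
        rw [← indicator_add']
        congr 1
        ext x
        simp [ofPieces, mul_add, Finset.sum_add_distrib]
      map_smul' := fun c q => by
        ext x
        by_cases hx : x ∈ gridSet n <;> simp [hx, ofPieces, Finset.mul_sum, mul_left_comm] }
  let ρ : splineSpace p n₀ ℓ →ₗ[ℝ] ℝ → ℝ :=
    { toFun := fun u => (gridSet n)ᶜ.indicator u
      map_add' := fun u v => by rw [← indicator_add']; rfl
      map_smul' := fun c u => by
        ext x
        by_cases hx : x ∈ gridSet n <;> simp [hx] }
  have hρ : ∀ u, ρ u ∈ LinearMap.range Φ := fun u => by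
    obtain ⟨q, hqd, hq⟩ := exists_pieces u.2
    refine ⟨fun i => ⟨q i, Polynomial.mem_degreeLT.2 ?_⟩, ?_⟩
    · refine lt_of_le_of_lt Polynomial.degree_le_natDegree ?_
      exact_mod_cast Nat.lt_succ_of_le (hqd i)
    · ext x
      by_cases hx : x ∈ gridSet n
      · simp [Φ, ρ, hx]
      · simp only [Φ, ρ, LinearMap.coe_mk, AddHom.coe_mk, indicator_of_mem (mem_compl hx)]
        exact (eq_ofPieces hn (fun x hx _ => u.2.1 x hx) hq x hx).symm
  have : Module.Finite ℝ (Polynomial.degreeLT ℝ (p + 1)) :=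
    Module.Finite.equiv (Polynomial.degreeLTEquiv ℝ (p + 1)).symm
  refine Module.Finite.of_injective (LinearMap.codRestrict (LinearMap.range Φ) ρ hρ) ?_
  intro u v huv
  have h1 : ρ u = ρ v := congrArg Subtype.val huv
  refine Subtype.ext (splineSpace_eq_of_ae u.2 v.2 (ae_restrict_of_ae ?_))
  have h0 : ∀ᵐ x : ℝ, x ∉ gridSet n := compl_mem_ae_iff.2 ((finite_gridSet n).measure_zero _)
  filter_upwards [h0] with x hx
  have := congrFun h1 x
  simpa [ρ, hx] using this

theorem exists_eq_add_prim (hn : 0 < gridCount n₀ ℓ) (u : splineSpace p n₀ ℓ) : ∃ c : ℝ, ∀ x ∈ Ioo (0 : ℝ) 1,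
    (u : ℝ → ℝ) x = ((c • 1 + prim (splineDeriv hn u) : pwAlg) : ℝ → ℝ) x := by
  set g := splineDeriv hn u with hg
  -- The base point is interior because the extension by zero may jump at 0.
  refine ⟨(u : ℝ → ℝ) (1 / 2) - (prim g : ℝ → ℝ) (1 / 2), fun x hx => ?_⟩
  have hsub : uIcc (1 / 2) x ⊆ Ioo (0 : ℝ) 1 :=
    ordConnected_Ioo.uIcc_subset (by norm_num) hx
  have h1 : ∫ t in (1 / 2)..x, (g : ℝ → ℝ) t = (u : ℝ → ℝ) x - (u : ℝ → ℝ) (1 / 2) := by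
    refine integral_eq_of_hasDerivAt_off_countable _ _ (finite_gridSet (gridCount n₀ ℓ)).countable
      ((splineSpace_continuousOn u.2).mono hsub) (fun y hy => ?_)
      (pwAlg_intervalIntegrable g.2 _ _)
    rw [hg, splineDeriv_apply hn u hy.2]
    exact (splineSpace_differentiableAt hn u.2 hy.2).hasDerivAt
  have h2 := intervalIntegral.integral_add_adjacent_intervals
    (pwAlg_intervalIntegrable g.2 0 (1 / 2)) (pwAlg_intervalIntegrable g.2 (1 / 2) x)
  simp only [Subalgebra.coe_add, Pi.add_apply, prim_apply, ← h2, h1, Subalgebra.coe_smul,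
    Subalgebra.coe_one, Pi.smul_apply, Pi.one_apply, smul_eq_mul, mul_one]
  ring

/-- The `L²` scalar product on the spline space. -/
noncomputable def massForm (hn : 0 < gridCount n₀ ℓ) : splineSpace p n₀ ℓ →ₗ[ℝ] splineSpace p n₀ ℓ →ₗ[ℝ] ℝ :=
  (l2Form 0 1).compl₁₂ (splineIncl hn) (splineIncl hn)

/-- The scalar product of derivatives on the spline space. -/
noncomputable def stiffForm (hn : 0 < gridCount n₀ ℓ) : splineSpace p n₀ ℓ →ₗ[ℝ] splineSpace p n₀ ℓ →ₗ[ℝ] ℝ :=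
  (l2Form 0 1).compl₁₂ (splineDeriv hn) (splineDeriv hn)

/-- The mean value of a spline. -/
noncomputable def splineMean (hn : 0 < gridCount n₀ ℓ) : splineSpace p n₀ ℓ →ₗ[ℝ] ℝ :=
  (l2Form 0 1 1).comp (splineIncl hn)

theorem massForm_apply (hn : 0 < gridCount n₀ ℓ) (u v : splineSpace p n₀ ℓ) :
    massForm hn u v = l2Form 0 1 (splineIncl hn u) (splineIncl hn v) := rfl

theorem stiffForm_apply (hn : 0 < gridCount n₀ ℓ) (u v : splineSpace p n₀ ℓ) :
    stiffForm hn u v = l2Form 0 1 (splineDeriv hn u) (splineDeriv hn v) := rfl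

theorem isPSDForm_massForm (hn : 0 < gridCount n₀ ℓ) : IsPSDForm (massForm (p := p) hn) where
  symm _ _ := (isPSDForm_l2Form zero_le_one).symm _ _
  nonneg _ := (isPSDForm_l2Form zero_le_one).nonneg _

theorem isPSDForm_stiffForm (hn : 0 < gridCount n₀ ℓ) : IsPSDForm (stiffForm (p := p) hn) where
  symm _ _ := (isPSDForm_l2Form zero_le_one).symm _ _
  nonneg _ := (isPSDForm_l2Form zero_le_one).nonneg _

theorem massForm_definite (hn : 0 < gridCount n₀ ℓ) (u : splineSpace p n₀ ℓ) (hu : massForm hn u u = 0) : u = 0 := by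
  have hint : IntegrableOn (fun x => (u : ℝ → ℝ) x * (u : ℝ → ℝ) x) (Ioc 0 1) := by
    have := intervalIntegrable_mul (splineIncl hn u) (splineIncl hn u) 0 1
    rwa [intervalIntegrable_iff_integrableOn_Ioc_of_le zero_le_one] at this
  rw [massForm_apply, l2Form_apply, splineIncl_apply,
    intervalIntegral.integral_of_le zero_le_one,
    integral_eq_zero_iff_of_nonneg (fun x => mul_self_nonneg _) hint] at hu
  refine Subtype.ext (splineSpace_eq_of_ae u.2 (Submodule.zero_mem _) ?_)
  have h1 := ae_mono (Measure.restrict_mono Ioo_subset_Ioc_self le_rfl) hu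
  filter_upwards [h1] with x hx
  simpa using hx

/-- A spline which is orthogonal to all splines in `S̃`, with respect to the mean value and the
derivatives, satisfies a Poincaré inequality with the grid size as constant. -/
theorem massForm_le_stiffForm (hn : 0 < gridCount n₀ ℓ) {q : ℕ} (e : splineSpace (q + 1) n₀ ℓ) (he : splineMean hn e = 0)
    (ho : ∀ w : splineSpace (q + 1) n₀ ℓ, (w : ℝ → ℝ) ∈ splineTilde (q + 1) n₀ ℓ →
      stiffForm hn e w = 0) :
    massForm hn e e ≤ gridSize n₀ ℓ ^ 2 * stiffForm hn e e := by
  have hB := isPSDForm_l2Form (zero_le_one' ℝ)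
  obtain ⟨c, hc⟩ := exists_eq_add_prim hn e
  set r := splineDeriv hn e with hr
  set f : pwAlg := c • 1 + prim r with hf
  have hff : massForm hn e e = l2Form 0 1 f f :=
    l2Form_congr finite_empty (fun x hx _ => hc x hx) (fun x hx _ => hc x hx)
  have hf1 : l2Form 0 1 1 f = 0 := by
    refine Eq.trans ?_ he
    exact (l2Form_congr (f := 1) (g := splineIncl hn e) finite_empty (fun _ _ _ => rfl)
      (fun x hx _ => hc x hx)).symm
  have key : l2Form 0 1 f f = -l2Form 0 1 r (prim f) := by
    have h1 := l2Form_prim_add r f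
    rw [hB.symm f 1, hf1, mul_zero] at h1
    have h2 : l2Form 0 1 f f = c * l2Form 0 1 1 f + l2Form 0 1 (prim r) f := by
      conv_lhs => rw [hf, map_add (l2Form 0 1), map_smul (l2Form 0 1), LinearMap.add_apply,
        LinearMap.smul_apply, smul_eq_mul, ← hf]
    rw [h2, hf1]
    linarith
  -- The mean-free half is used at level q, one below the degree, since the derivative r is to be
  -- tested against that space.
  have happ := (exists_ladder_approx hB (sq_nonneg (gridSize n₀ ℓ))
    (one_mem_pwConst (gridCount n₀ ℓ)) l2Form_one_one l2Form_prim_add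
    (fun c g => exists_pwConst_approx hn c g) q).2 f hf1
  rw [hff, stiffForm_apply]
  refine hB.duality (sq_nonneg _) key (fun y hy => ?_) happ
  -- Every y in the second ladder space is almost everywhere the derivative of a function in S̃, so
  -- orthogonality to S̃ makes r orthogonal to y.
  have hy' : prim y ∈ (splineLadder (gridCount n₀ ℓ) (q + 1)).1 :=
    mem_splineLadder_succ_fst.2 ⟨0, y, hy, by simp⟩
  have hw := indicator_mem_splineTilde hn hy'
  have h2 := ho ⟨_, hw.1⟩ hw
  rw [stiffForm_apply] at h2
  refine Eq.trans ?_ h2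
  obtain ⟨N, hN, hNc, -⟩ := y.2
  refine l2Form_congr (hN.union (finite_gridSet (gridCount n₀ ℓ))) (fun _ _ _ => rfl)
    fun x hx hxN => ?_
  rw [splineDeriv_apply hn _ fun h => hxN (Or.inr h)]
  have hd := hasDerivAt_prim y (hNc x fun h => hxN (Or.inl h))
  refine (HasDerivAt.deriv (hd.congr_of_eventuallyEq ?_)).symm
  filter_upwards [isOpen_Ioo.mem_nhds hx] with t ht using indicator_of_mem ht _

theorem indicator_one_mem_splineTilde {q : ℕ} (hn : 0 < gridCount n₀ ℓ) :
    (Ioo (0 : ℝ) 1).indicator ((1 : pwAlg) : ℝ → ℝ) ∈ splineTilde (q + 1) n₀ ℓ :=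
  indicator_mem_splineTilde hn (mem_splineLadder_succ_fst.2 ⟨1, 0, Submodule.zero_mem _, by simp⟩)

/-- The error operator of the `H¹` projector onto `S̃`. -/
theorem exists_spline_error_operator (hn : 0 < gridCount n₀ ℓ) (hp : 1 ≤ p) :
    ∃ E : splineSpace p n₀ ℓ →ₗ[ℝ] splineSpace p n₀ ℓ,
      (∀ u, ((u - E u : splineSpace p n₀ ℓ) : ℝ → ℝ) ∈ splineTilde p n₀ ℓ) ∧
      (∀ u, massForm hn (E u) (E u) ≤ gridSize n₀ ℓ ^ 2 * stiffForm hn (E u) (E u)) ∧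
      ∀ u, stiffForm hn (E u) (E u) = stiffForm hn (E u) u := by
  obtain ⟨q, rfl⟩ : ∃ q, p = q + 1 := ⟨p - 1, by omega⟩
  have := finiteDimensional_splineSpace (p := q + 1) hn
  -- The mean term controls constants. Testing with the constant 1 in S̃ shows that the error has
  -- mean zero, after which this term drops out of the orthogonality relation.
  let a := stiffForm (p := q + 1) hn +
    (LinearMap.mul ℝ ℝ).compl₁₂ (splineMean (p := q + 1) hn) (splineMean hn)
  have ha : ∀ u v, a u v = stiffForm hn u v + splineMean hn u * splineMean hn v := fun _ _ => rfl
  have haP : IsPSDForm a :=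
    ⟨fun u v => by rw [ha, ha, (isPSDForm_stiffForm hn).symm, mul_comm],
      fun u => add_nonneg ((isPSDForm_stiffForm hn).nonneg u) (mul_self_nonneg _)⟩
  obtain ⟨Q, hQ, hQo⟩ := haP.exists_projector
    ((splineTilde (q + 1) n₀ ℓ).comap (splineSpace (q + 1) n₀ ℓ).subtype)
  have hone := indicator_one_mem_splineTilde (q := q) hn
  let w₁ : splineSpace (q + 1) n₀ ℓ := ⟨_, hone.1⟩
  have hd1 : ∀ x ∈ Ioo (0 : ℝ) 1, x ∉ gridSet (gridCount n₀ ℓ) →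
      (splineDeriv hn w₁ : ℝ → ℝ) x = ((0 : pwAlg) : ℝ → ℝ) x := fun x hx hxN => by
    rw [splineDeriv_apply hn _ hxN]
    refine HasDerivAt.deriv ((hasDerivAt_const x (1 : ℝ)).congr_of_eventuallyEq ?_)
    filter_upwards [isOpen_Ioo.mem_nhds hx] with t ht using indicator_of_mem ht _
  have hk1 : ∀ u, stiffForm hn u w₁ = 0 := fun u => by
    rw [stiffForm_apply, l2Form_congr (finite_gridSet (gridCount n₀ ℓ)) (fun _ _ _ => rfl) hd1]
    simp
  have hm1 : splineMean hn w₁ = 1 := by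
    rw [← l2Form_one_one]
    exact l2Form_congr finite_empty (fun _ _ _ => rfl) fun x hx _ => indicator_of_mem hx _
  have hmean : ∀ u, splineMean hn (u - Q u) = 0 := fun u => by
    have := hQo u w₁ hone
    rwa [ha, hk1, hm1, zero_add, mul_one] at this
  have hk : ∀ u w : splineSpace (q + 1) n₀ ℓ, (w : ℝ → ℝ) ∈ splineTilde (q + 1) n₀ ℓ → stiffForm hn (u - Q u) w = 0 :=
    fun u w hw => by
      have := hQo u w hw
      rwa [ha, hmean, zero_mul, add_zero] at this
  refine ⟨LinearMap.id - Q, fun u => ?_, fun u => ?_, fun u => ?_⟩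
  · have h : u - (LinearMap.id - Q : _ →ₗ[ℝ] _) u = Q u := by simp
    rw [h]
    exact hQ u
  · exact massForm_le_stiffForm hn (u - Q u) (hmean u) (hk u)
  · change stiffForm hn (u - Q u) (u - Q u) = stiffForm hn (u - Q u) u
    rw [map_sub (stiffForm hn (u - Q u)), hk u (Q u) (hQ u), sub_zero]

end Spline

/-! ### Fubini and Parseval on the unit square -/

section Square

theorem restrict_unitSquare : (volume : Measure (ℝ × ℝ)).restrict unitSquare =
    (volume.restrict (Ioo (0 : ℝ) 1)).prod (volume.restrict (Ioo (0 : ℝ) 1)) := by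
  rw [Measure.prod_restrict]; rfl

theorem integrable_unitInterval (f : pwAlg) :
    Integrable (f : ℝ → ℝ) (volume.restrict (Ioo (0 : ℝ) 1)) := by
  have := pwAlg_intervalIntegrable f.2 0 1
  rw [intervalIntegrable_iff_integrableOn_Ioc_of_le zero_le_one] at this
  exact this.mono_set Ioo_subset_Ioc_self

theorem l2Form_eq_setIntegral (f g : pwAlg) :
    l2Form 0 1 f g = ∫ x in Ioo (0 : ℝ) 1, ((f * g : pwAlg) : ℝ → ℝ) x := by
  rw [l2Form_apply, intervalIntegral.integral_of_le zero_le_one, integral_Ioc_eq_integral_Ioo]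
  rfl

theorem ae_fst_notMem {N : Set ℝ} (hN : N.Finite) :
    ∀ᵐ z ∂(volume : Measure (ℝ × ℝ)).restrict unitSquare, z.1 ∉ N :=
  ae_restrict_of_ae (Measure.quasiMeasurePreserving_fst.ae
    (compl_mem_ae_iff.2 (hN.measure_zero volume)))

theorem ae_snd_notMem {N : Set ℝ} (hN : N.Finite) :
    ∀ᵐ z ∂(volume : Measure (ℝ × ℝ)).restrict unitSquare, z.2 ∉ N :=
  ae_restrict_of_ae (Measure.quasiMeasurePreserving_snd.ae
    (compl_mem_ae_iff.2 (hN.measure_zero volume)))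

variable {ι : Type*} [Fintype ι] [DecidableEq ι]

/-- Parseval's identity for tensor products of orthogonal systems. -/
theorem l2Inner_eq_sum {f g : ι → pwAlg} {α β : ι → ℝ}
    (hf : ∀ i j, l2Form 0 1 (f i) (f j) = if i = j then α i else 0)
    (hg : ∀ i j, l2Form 0 1 (g i) (g j) = if i = j then β i else 0)
    {w w' : ℝ × ℝ → ℝ} {U V : Matrix ι ι ℝ}
    (hw : ∀ᵐ z ∂(volume : Measure (ℝ × ℝ)).restrict unitSquare,
      w z = ∑ i, ∑ j, U i j * ((f i : ℝ → ℝ) z.1 * (g j : ℝ → ℝ) z.2))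
    (hw' : ∀ᵐ z ∂(volume : Measure (ℝ × ℝ)).restrict unitSquare,
      w' z = ∑ i, ∑ j, V i j * ((f i : ℝ → ℝ) z.1 * (g j : ℝ → ℝ) z.2)) :
    l2Inner w w' = ∑ i, ∑ j, α i * β j * (U i j * V i j) := by
  have h1 : l2Inner w w' = ∫ z in unitSquare, ∑ x : (ι × ι) × (ι × ι),
      U x.1.1 x.1.2 * V x.2.1 x.2.2 * (((f x.1.1 * f x.2.1 : pwAlg) : ℝ → ℝ) z.1 *
        ((g x.1.2 * g x.2.2 : pwAlg) : ℝ → ℝ) z.2) := by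
    refine integral_congr_ae ?_
    filter_upwards [hw, hw'] with z hz hz'
    rw [hz, hz', ← Fintype.sum_prod_type', ← Fintype.sum_prod_type', Finset.sum_mul_sum,
      ← Fintype.sum_prod_type']
    refine Finset.sum_congr rfl fun x _ => ?_
    simp only [Subalgebra.coe_mul, Pi.mul_apply]
    ring
  have h2 : ∀ x : (ι × ι) × (ι × ι), ∫ z in unitSquare,
      U x.1.1 x.1.2 * V x.2.1 x.2.2 * (((f x.1.1 * f x.2.1 : pwAlg) : ℝ → ℝ) z.1 *
        ((g x.1.2 * g x.2.2 : pwAlg) : ℝ → ℝ) z.2) =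
      U x.1.1 x.1.2 * V x.2.1 x.2.2 * ((if x.1.1 = x.2.1 then α x.1.1 else 0) *
        (if x.1.2 = x.2.2 then β x.1.2 else 0)) := fun x => by
    rw [integral_const_mul, ← hf, ← hg, l2Form_eq_setIntegral, l2Form_eq_setIntegral,
      restrict_unitSquare, integral_prod_mul]
  rw [h1, integral_finsetSum _ fun x _ => ?_, Finset.sum_congr rfl fun x _ => h2 x]
  · simp only [Fintype.sum_prod_type]
    refine Finset.sum_congr rfl fun i _ => Finset.sum_congr rfl fun j _ => ?_
    rw [Finset.sum_eq_single i, Finset.sum_eq_single j]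
    · simp; ring
    · intro l _ hl; simp [hl.symm]
    · simp
    · intro k _ hk; simp [hk.symm]
    · simp
  · rw [restrict_unitSquare]
    exact ((integrable_unitInterval _).mul_prod (integrable_unitInterval _)).const_mul _

end Square

/-! ### Tensor product coordinates and the energy projector -/

section Tensor

variable {p n₀ ℓ : ℕ} {ι : Type*} [Fintype ι]

theorem splineTilde2_le : splineTilde2 p n₀ ℓ ≤ splineSpace2 p n₀ ℓ := by
  refine Submodule.span_mono ?_
  rintro w ⟨f, hf, g, hg, rfl⟩
  exact ⟨f, hf.1, g, hg.1, rfl⟩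

/-- The function with given coefficients with respect to the tensor products of splines. -/
def ofCoeff (φ : ι → splineSpace p n₀ ℓ) : Matrix ι ι ℝ →ₗ[ℝ] ℝ × ℝ → ℝ where
  toFun U z := ∑ i, ∑ j, U i j * ((φ i : ℝ → ℝ) z.1 * (φ j : ℝ → ℝ) z.2)
  map_add' U V := by
    ext z
    simp [add_mul, Finset.sum_add_distrib]
  map_smul' c U := by
    ext z
    simp [Finset.mul_sum, mul_assoc]

theorem ofCoeff_apply (φ : ι → splineSpace p n₀ ℓ) (U : Matrix ι ι ℝ) (z : ℝ × ℝ) :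
    ofCoeff φ U z = ∑ i, ∑ j, U i j * ((φ i : ℝ → ℝ) z.1 * (φ j : ℝ → ℝ) z.2) := rfl

theorem ofCoeff_mem {V : Submodule ℝ (ℝ → ℝ)} {φ : ι → splineSpace p n₀ ℓ}
    (hφ : ∀ i, (φ i : ℝ → ℝ) ∈ V) (U : Matrix ι ι ℝ) : ofCoeff φ U ∈ tensorSpace V V := by
  have h : ofCoeff φ U = ∑ i, ∑ j, U i j •
      fun z : ℝ × ℝ => (φ i : ℝ → ℝ) z.1 * (φ j : ℝ → ℝ) z.2 := by
    ext z
    simp [ofCoeff_apply]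
  rw [h]
  exact sum_mem fun i _ => sum_mem fun j _ => Submodule.smul_mem _ _
    (Submodule.subset_span ⟨_, hφ i, _, hφ j, rfl⟩)

theorem coe_eq_sum_repr (φ : Module.Basis ι ℝ (splineSpace p n₀ ℓ)) (u : splineSpace p n₀ ℓ)
    (x : ℝ) : (u : ℝ → ℝ) x = ∑ i, φ.repr u i * (φ i : ℝ → ℝ) x := by
  have h := congrFun (congrArg Subtype.val (φ.sum_repr u)) x
  rw [← h]
  simp [-Module.Basis.sum_repr]

theorem range_ofCoeff (φ : Module.Basis ι ℝ (splineSpace p n₀ ℓ)) :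
    LinearMap.range (ofCoeff φ) = splineSpace2 p n₀ ℓ := by
  refine le_antisymm ?_ ?_
  · rintro _ ⟨U, rfl⟩
    exact ofCoeff_mem (fun i => (φ i).2) U
  · refine Submodule.span_le.2 ?_
    rintro w ⟨f, hf, g, hg, rfl⟩
    refine ⟨Matrix.of fun i j => φ.repr ⟨f, hf⟩ i * φ.repr ⟨g, hg⟩ j, ?_⟩
    funext z
    symm
    rw [ofCoeff_apply, show f z.1 = _ from coe_eq_sum_repr φ ⟨f, hf⟩ z.1,
      show g z.2 = _ from coe_eq_sum_repr φ ⟨g, hg⟩ z.2, Finset.sum_mul_sum]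
    refine Finset.sum_congr rfl fun i _ => Finset.sum_congr rfl fun j _ => ?_
    rw [Matrix.of_apply]
    ring

variable [DecidableEq ι]

/-- Applying a linear map of the spline space in both variables. -/
theorem ofCoeff_toMatrix_mul (φ : Module.Basis ι ℝ (splineSpace p n₀ ℓ))
    (P : splineSpace p n₀ ℓ →ₗ[ℝ] splineSpace p n₀ ℓ) (Z : Matrix ι ι ℝ) :
    ofCoeff φ (LinearMap.toMatrix φ φ P * Z * (LinearMap.toMatrix φ φ P).transpose) =
      ofCoeff (fun i => P (φ i)) Z := by
  set A := LinearMap.toMatrix φ φ P with hA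
  have hP : ∀ k x, (P (φ k) : ℝ → ℝ) x = ∑ i, A i k * (φ i : ℝ → ℝ) x := fun k x => by
    simp only [hA, LinearMap.toMatrix_apply]
    exact coe_eq_sum_repr φ _ x
  ext z
  simp only [ofCoeff_apply, hP, Matrix.mul_apply, Matrix.transpose_apply, Finset.sum_mul_sum]
  simp only [Finset.sum_mul, Finset.mul_sum]
  calc _ = ∑ i, ∑ l, ∑ j, ∑ k, A i k * Z k l * A j l * ((φ i : ℝ → ℝ) z.1 * (φ j : ℝ → ℝ) z.2) :=
        Finset.sum_congr rfl fun i _ => Finset.sum_comm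
    _ = ∑ i, ∑ l, ∑ k, ∑ j, A i k * Z k l * A j l * ((φ i : ℝ → ℝ) z.1 * (φ j : ℝ → ℝ) z.2) :=
        Finset.sum_congr rfl fun i _ => Finset.sum_congr rfl fun l _ => Finset.sum_comm
    _ = ∑ i, ∑ k, ∑ l, ∑ j, A i k * Z k l * A j l * ((φ i : ℝ → ℝ) z.1 * (φ j : ℝ → ℝ) z.2) :=
        Finset.sum_congr rfl fun i _ => Finset.sum_comm
    _ = ∑ k, ∑ i, ∑ l, ∑ j, A i k * Z k l * A j l * ((φ i : ℝ → ℝ) z.1 * (φ j : ℝ → ℝ) z.2) :=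
        Finset.sum_comm
    _ = ∑ k, ∑ l, ∑ i, ∑ j, A i k * Z k l * A j l * ((φ i : ℝ → ℝ) z.1 * (φ j : ℝ → ℝ) z.2) :=
        Finset.sum_congr rfl fun i _ => Finset.sum_comm
    _ = _ := by
        refine Finset.sum_congr rfl fun k _ => Finset.sum_congr rfl fun l _ =>
          Finset.sum_congr rfl fun i _ => Finset.sum_congr rfl fun j _ => ?_
        ring

variable (hn : 0 < gridCount n₀ ℓ) {φ : Module.Basis ι ℝ (splineSpace p n₀ ℓ)} {μ : ι → ℝ}

/-- A basis of the spline space which is orthonormal in `L²` and orthogonal with respect to the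
scalar product of derivatives. -/
structure IsEigenbasis (φ : Module.Basis ι ℝ (splineSpace p n₀ ℓ)) (μ : ι → ℝ) : Prop where
  nonneg : ∀ i, 0 ≤ μ i
  mass : ∀ i j, massForm hn (φ i) (φ j) = if i = j then 1 else 0
  stiff : ∀ i j, stiffForm hn (φ i) (φ j) = if i = j then μ i else 0

variable {hn}

theorem IsEigenbasis.l2Inner_ofCoeff (hφ : IsEigenbasis hn φ μ) (U V : Matrix ι ι ℝ) :
    l2Inner (ofCoeff φ U) (ofCoeff φ V) = ∑ i, ∑ j, U i j * V i j := by
  refine (l2Inner_eq_sum (f := fun i => splineIncl hn (φ i)) (g := fun i => splineIncl hn (φ i))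
    hφ.mass hφ.mass (ae_of_all _ (ofCoeff_apply _ U)) (ae_of_all _ (ofCoeff_apply _ V))).trans ?_
  simp

/-- Off the grid lines each partial derivative differentiates a single factor. The differentiated
basis is still orthogonal, with squared norms μ_i, so Parseval yields the three summands of the
weight. -/
theorem IsEigenbasis.energyInner_ofCoeff (hφ : IsEigenbasis hn φ μ) (U V : Matrix ι ι ℝ) :
    energyInner (ofCoeff φ U) (ofCoeff φ V) = matEnergy μ U V := by
  have hX : ∀ U : Matrix ι ι ℝ, ∀ᵐ z ∂(volume : Measure (ℝ × ℝ)).restrict unitSquare,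
      partialX (ofCoeff φ U) z = ∑ i, ∑ j, U i j *
        ((splineDeriv hn (φ i) : ℝ → ℝ) z.1 * (splineIncl hn (φ j) : ℝ → ℝ) z.2) := fun U => by
    filter_upwards [ae_fst_notMem (finite_gridSet (gridCount n₀ ℓ))] with z hz
    simp only [splineDeriv_apply hn _ hz]
    have h : HasDerivAt (fun s => ∑ i, ∑ j, U i j * ((φ i : ℝ → ℝ) s * (φ j : ℝ → ℝ) z.2))
        (∑ i, ∑ j, U i j * (deriv (φ i : ℝ → ℝ) z.1 * (φ j : ℝ → ℝ) z.2)) z.1 :=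
      HasDerivAt.fun_sum fun i _ => HasDerivAt.fun_sum fun j _ =>
        ((splineSpace_differentiableAt hn (φ i).2 hz).hasDerivAt.mul_const _).const_mul _
    exact h.deriv
  have hY : ∀ U : Matrix ι ι ℝ, ∀ᵐ z ∂(volume : Measure (ℝ × ℝ)).restrict unitSquare,
      partialY (ofCoeff φ U) z = ∑ i, ∑ j, U i j *
        ((splineIncl hn (φ i) : ℝ → ℝ) z.1 * (splineDeriv hn (φ j) : ℝ → ℝ) z.2) := fun U => by
    filter_upwards [ae_snd_notMem (finite_gridSet (gridCount n₀ ℓ))] with z hz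
    simp only [splineDeriv_apply hn _ hz]
    have h : HasDerivAt (fun s => ∑ i, ∑ j, U i j * ((φ i : ℝ → ℝ) z.1 * (φ j : ℝ → ℝ) s))
        (∑ i, ∑ j, U i j * ((φ i : ℝ → ℝ) z.1 * deriv (φ j : ℝ → ℝ) z.2)) z.2 :=
      HasDerivAt.fun_sum fun i _ => HasDerivAt.fun_sum fun j _ =>
        ((splineSpace_differentiableAt hn (φ j).2 hz).hasDerivAt.const_mul _).const_mul _
    exact h.deriv
  rw [energyInner, hφ.l2Inner_ofCoeff,
    l2Inner_eq_sum (f := fun i => splineDeriv hn (φ i)) (g := fun i => splineIncl hn (φ i))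
      hφ.stiff hφ.mass (hX U) (hX V),
    l2Inner_eq_sum (f := fun i => splineIncl hn (φ i)) (g := fun i => splineDeriv hn (φ i))
      hφ.mass hφ.stiff (hY U) (hY V)]
  simp only [matEnergy, ← Finset.sum_add_distrib]
  refine Finset.sum_congr rfl fun i _ => Finset.sum_congr rfl fun j _ => ?_
  ring

theorem apply_eq_sum_repr (φ : Module.Basis ι ℝ (splineSpace p n₀ ℓ))
    {B : splineSpace p n₀ ℓ →ₗ[ℝ] splineSpace p n₀ ℓ →ₗ[ℝ] ℝ} {α : ι → ℝ}
    (hB : ∀ i j, B (φ i) (φ j) = if i = j then α i else 0) (u v : splineSpace p n₀ ℓ) :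
    B u v = ∑ i, α i * (φ.repr u i * φ.repr v i) := by
  conv_lhs => rw [← φ.sum_repr u, ← φ.sum_repr v]
  simp only [map_sum, map_smul, LinearMap.sum_apply, LinearMap.smul_apply, hB, smul_eq_mul]
  refine Finset.sum_congr rfl fun i _ => ?_
  rw [Finset.sum_eq_single i]
  · simp; ring
  · intro j _ hj; simp [hj]
  · simp

theorem IsEigenbasis.isErrorMatrix (hφ : IsEigenbasis hn φ μ)
    {E : splineSpace p n₀ ℓ →ₗ[ℝ] splineSpace p n₀ ℓ} {h : ℝ}
    (h1 : ∀ u, massForm hn (E u) (E u) ≤ h ^ 2 * stiffForm hn (E u) (E u))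
    (h2 : ∀ u, stiffForm hn (E u) (E u) = stiffForm hn (E u) u) :
    IsErrorMatrix μ h (LinearMap.toMatrix φ φ E) := by
  have hmass : ∀ u, massForm hn u u = ∑ i, φ.repr u i ^ 2 := fun u => by
    rw [apply_eq_sum_repr φ hφ.mass]
    exact Finset.sum_congr rfl fun i _ => by ring
  have hstiff : ∀ u, stiffForm hn u u = ∑ i, μ i * φ.repr u i ^ 2 := fun u => by
    rw [apply_eq_sum_repr φ hφ.stiff]
    exact Finset.sum_congr rfl fun i _ => by ring
  have hcoord : ∀ a : ι → ℝ, ∃ u, (φ.repr u : ι → ℝ) = a ∧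
      (LinearMap.toMatrix φ φ E).mulVec a = φ.repr (E u) := fun a => by
    have ha : (φ.repr (φ.equivFun.symm a) : ι → ℝ) = a := φ.equivFun.apply_symm_apply a
    exact ⟨φ.equivFun.symm a, ha, by rw [← LinearMap.toMatrix_mulVec_repr φ φ E, ha]⟩
  have hpsd := isPSDForm_stiffForm (p := p) hn
  refine ⟨fun a => ?_, fun a => ?_, fun a => ?_⟩
  · obtain ⟨u, rfl, hu⟩ := hcoord a
    rw [hu, ← hmass, ← hstiff]
    exact h1 u
  · obtain ⟨u, rfl, hu⟩ := hcoord a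
    rw [hu, ← hstiff, ← hstiff]
    have h3 := hpsd.cauchy_schwarz (E u) u
    rw [← h2, sq] at h3
    rcases (hpsd.nonneg (E u)).eq_or_lt with h0 | h0
    · rw [← h0]; exact hpsd.nonneg u
    · exact le_of_mul_le_mul_left h3 h0
  · obtain ⟨u, rfl, hu⟩ := hcoord a
    rw [hu, ← hstiff]
    set s := stiffForm hn (E u) (E u) with hs
    set t := ∑ i, μ i ^ 2 * φ.repr u i ^ 2 with ht
    have ht0 : 0 ≤ t := Finset.sum_nonneg fun i _ => by positivity
    have h3 : s ^ 2 ≤ massForm hn (E u) (E u) * t := by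
      -- The numbers μ_i u_i are the coordinates of the discrete Laplacian of u. Moving both
      -- derivatives onto u leaves Eu undifferentiated, and its L² norm costs only h times the
      -- square root of s.
      have h4 : s = ∑ i, φ.repr (E u) i * (μ i * φ.repr u i) := by
        rw [hs, h2, apply_eq_sum_repr φ hφ.stiff]
        exact Finset.sum_congr rfl fun i _ => by ring
      have h5 : t = ∑ i, (μ i * φ.repr u i) ^ 2 := Finset.sum_congr rfl fun i _ => by ring
      rw [h4, hmass, h5]
      exact Finset.sum_mul_sq_le_sq_mul_sq _ _ _
    have h6 := h3.trans (mul_le_mul_of_nonneg_right (h1 u) ht0)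
    rcases (hpsd.nonneg (E u)).eq_or_lt with h0 | h0
    · rw [hs, ← h0]; positivity
    · refine le_of_mul_le_mul_left ?_ h0
      rw [← hs]
      linarith

theorem exists_isEigenbasis (hn : 0 < gridCount n₀ ℓ) :
    ∃ (φ : Module.Basis (Fin (Module.finrank ℝ (splineSpace p n₀ ℓ))) ℝ (splineSpace p n₀ ℓ))
      (μ : Fin (Module.finrank ℝ (splineSpace p n₀ ℓ)) → ℝ), IsEigenbasis hn φ μ := by
  have := finiteDimensional_splineSpace (p := p) hn
  obtain ⟨φ, μ, h0, hm, hk⟩ := IsPSDForm.exists_eigenbasis (isPSDForm_massForm (p := p) hn)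
    (massForm_definite hn) (isPSDForm_stiffForm hn)
  exact ⟨φ, μ, h0, hm, hk⟩

theorem IsEigenbasis.existsUnique_isEnergyProjector (hφ : IsEigenbasis hn φ μ) :
    ∃! T : splineSpace2 p n₀ ℓ →ₗ[ℝ] splineTilde2 p n₀ ℓ, IsEnergyProjector T := by
  have hmem : ∀ {u}, u ∈ splineSpace2 p n₀ ℓ → ∃ U, ofCoeff φ U = u := fun {u} hu => by
    rw [← range_ofCoeff φ] at hu
    exact hu
  obtain ⟨Q, hQ, hQo⟩ := (isPSDForm_matEnergyForm hφ.nonneg).exists_projector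
    ((splineTilde2 p n₀ ℓ).comap (ofCoeff φ))
  -- A linear choice of coefficient matrix for each tensor spline.
  obtain ⟨R, hR⟩ := LinearMap.exists_rightInverse_of_surjective
    (LinearMap.codRestrict (splineSpace2 p n₀ ℓ) (ofCoeff φ)
      fun U => ofCoeff_mem (fun i => (φ i).2) U)
    (LinearMap.range_eq_top.2 fun u => by
      obtain ⟨U, hU⟩ := hmem u.2
      exact ⟨U, Subtype.ext hU⟩)
  have hRu : ∀ u : splineSpace2 p n₀ ℓ, ofCoeff φ (R u) = u := fun u =>
    congrArg Subtype.val (LinearMap.congr_fun hR u)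
  refine ⟨LinearMap.codRestrict (splineTilde2 p n₀ ℓ) (ofCoeff φ ∘ₗ Q ∘ₗ R) fun u => hQ (R u),
    fun u w => ?_, fun T hT => ?_⟩
  · obtain ⟨W, hW⟩ := hmem (splineTilde2_le w.2)
    have h1 : (u : ℝ × ℝ → ℝ) - ofCoeff φ (Q (R u)) = ofCoeff φ (R u - Q (R u)) := by
      rw [map_sub, hRu]
    change energyInner ((u : ℝ × ℝ → ℝ) - ofCoeff φ (Q (R u))) w = 0
    rw [h1, ← hW, hφ.energyInner_ofCoeff]
    exact hQo (R u) W (by rw [Submodule.mem_comap, hW]; exact w.2)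
  · ext1 u
    refine Subtype.ext ?_
    change (T u : ℝ × ℝ → ℝ) = ofCoeff φ (Q (R u))
    obtain ⟨X, hX⟩ := hmem (splineTilde2_le (T u).2)
    set D := X - Q (R u) with hD
    have hDmem : ofCoeff φ D ∈ splineTilde2 p n₀ ℓ := by
      rw [hD, map_sub, hX]
      exact sub_mem (T u).2 (hQ (R u))
    have h1 : matEnergyForm μ (R u - Q (R u)) D = 0 := hQo (R u) D hDmem
    have h2 : matEnergyForm μ (R u - X) D = 0 := by
      have := hT u ⟨_, hDmem⟩
      rw [← hRu u, ← hX, ← map_sub, hφ.energyInner_ofCoeff] at this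
      exact this
    -- The difference of two projections lies in the subspace and is orthogonal to it, hence to
    -- itself.
    have h3 : matEnergyForm μ D D = 0 := by
      have h4 : D = (R u - Q (R u)) - (R u - X) := by rw [hD]; abel
      conv_lhs => rw [h4, map_sub (matEnergyForm μ), LinearMap.sub_apply, ← h4, h1, h2]
      simp
    rw [← hX, sub_eq_zero.1 (matEnergy_definite hφ.nonneg h3)]

theorem IsEigenbasis.l2Norm_sub_le (hφ : IsEigenbasis hn φ μ) (hp : 1 ≤ p)
    {T : splineSpace2 p n₀ ℓ →ₗ[ℝ] splineTilde2 p n₀ ℓ} (hT : IsEnergyProjector T)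
    (u : splineSpace2 p n₀ ℓ) :
    l2Norm ((u : ℝ × ℝ → ℝ) - (T u : ℝ × ℝ → ℝ)) ≤
      4 * gridSize n₀ ℓ * energyNorm (u : ℝ × ℝ → ℝ) := by
  have hmem : ∀ {u}, u ∈ splineSpace2 p n₀ ℓ → ∃ U, ofCoeff φ U = u := fun {u} hu => by
    rw [← range_ofCoeff φ] at hu
    exact hu
  have hn' : (1 : ℝ) ≤ gridCount n₀ ℓ := by exact_mod_cast hn
  have hh0 : 0 ≤ gridSize n₀ ℓ := by rw [gridSize]; positivity
  have hh1 : gridSize n₀ ℓ ^ 2 ≤ 1 := by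
    refine pow_le_one₀ hh0 ?_
    rw [gridSize]
    exact div_le_one_of_le₀ hn' (by linarith)
  obtain ⟨E, hEt, hE1, hE2⟩ := exists_spline_error_operator hn hp
  have hE := hφ.isErrorMatrix hE1 hE2
  obtain ⟨U, hU⟩ := hmem u.2
  obtain ⟨X, hX⟩ := hmem (splineTilde2_le (T u).2)
  have hort : ∀ W ∈ (splineTilde2 p n₀ ℓ).comap (ofCoeff φ), matEnergyForm μ (U - X) W = 0 :=
    fun W hW => by
      have := hT u ⟨_, hW⟩
      rw [← hU, ← hX, ← map_sub, hφ.energyInner_ofCoeff] at this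
      exact this
  have hXmem : X ∈ (splineTilde2 p n₀ ℓ).comap (ofCoeff φ) := by
    rw [Submodule.mem_comap, hX]; exact (T u).2
  have h1 := (isPSDForm_matEnergyForm hφ.nonneg).sub_projector_le hXmem hort
  have h2 := hE.aubin_nitsche hφ.nonneg hh1 (U - X) fun Z => by
    refine hort _ ?_
    -- As id - E maps into S̃, applying it in both variables produces an admissible test function.
    have hP : 1 - LinearMap.toMatrix φ φ E = LinearMap.toMatrix φ φ (LinearMap.id - E) := by
      rw [map_sub (LinearMap.toMatrix φ φ), LinearMap.toMatrix_id]
    rw [hP, Submodule.mem_comap, ofCoeff_toMatrix_mul]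
    exact ofCoeff_mem (fun i => hEt (φ i)) Z
  have h3 : l2Inner ((u : ℝ × ℝ → ℝ) - T u) ((u : ℝ × ℝ → ℝ) - T u) ≤
      (4 * gridSize n₀ ℓ) ^ 2 * energyInner (u : ℝ × ℝ → ℝ) u := by
    rw [← hU, ← hX, ← map_sub, hφ.l2Inner_ofCoeff, hφ.energyInner_ofCoeff]
    have h4 := mul_le_mul_of_nonneg_left h1 (by positivity : 0 ≤ 16 * gridSize n₀ ℓ ^ 2)
    simp only [matEnergyForm_apply, ← sq] at h2 h4 ⊢
    linarith
  rw [l2Norm, energyNorm]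
  refine (Real.sqrt_le_sqrt h3).trans_eq ?_
  rw [Real.sqrt_mul (sq_nonneg _), Real.sqrt_sq (by positivity)]

end Tensor

end SplineMG

theorem theorem5p1 :
    ∃ c : ℝ, 0 < c ∧ ∀ p n₀ ℓ : ℕ, 1 ≤ p → p < n₀ →
      (∃! T : SplineMG.splineSpace2 p n₀ ℓ →ₗ[ℝ] SplineMG.splineTilde2 p n₀ ℓ,
        SplineMG.IsEnergyProjector T) ∧
      ∀ T : SplineMG.splineSpace2 p n₀ ℓ →ₗ[ℝ] SplineMG.splineTilde2 p n₀ ℓ,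
        SplineMG.IsEnergyProjector T →
        ∀ u : SplineMG.splineSpace2 p n₀ ℓ,
          SplineMG.l2Norm ((u : ℝ × ℝ → ℝ) - (T u : ℝ × ℝ → ℝ)) ≤
            c * SplineMG.gridSize n₀ ℓ * SplineMG.energyNorm (u : ℝ × ℝ → ℝ) := by
  refine ⟨4, by norm_num, fun p n₀ ℓ hp hpn => ?_⟩
  have hn : 0 < SplineMG.gridCount n₀ ℓ :=
    Nat.mul_pos (by omega) (pow_pos two_pos ℓ)
  obtain ⟨φ, μ, hφ⟩ := SplineMG.exists_isEigenbasis (p := p) hn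
  exact ⟨hφ.existsUnique_isEnergyProjector, fun T hT u => hφ.l2Norm_sub_le hp hT u⟩
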